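/- **Notation.** Let $n\ge 0$, let $V=\mathbb{R}^n$ with the standard inner product and standard basis $e_1,\dots,e_n$, and in $V\oplus V$ write $e_i=(e_i,0)$, $\hat e_i=(0,e_i)$. Let $C(V,-V)$ be the Clifford algebra of $V\oplus V$ with the form $q=\langle\,,\rangle\oplus-\langle\,,\rangle$ and the convention $x\cdot y+y\cdot x=-2q(x,y)$. Let $C^k(V,-V)$ be the span of the products of at most $k$ vectors, and let $\sigma_k:C^k(V,-V)\to\Lambda^k(V\oplus V)$ be the $k$-th symbol map: $x_1\cdots x_k\mapsto x_1\wedge\dots\wedge x_k$, and $\sigma_k=0$ on $C^{k-1}(V,-V)$. The algebra $C(V,-V)$ acts on $\Lambda V$ by $e_i\mapsto\varepsilon(e_i)-\iota(e_i)$, $\hat e_i\mapsto\varepsilon(e_i)+\iota(e_i)$, with $\varepsilon,\iota$ exterior and interior multiplication; this identifies $C(V,-V)$ with $\operatorname{End}\Lambda V$. Put $\operatorname{Str}(a)=\operatorname{Tr}((-1)^{N}a)$ on $\operatorname{End}\Lambda V$, with $N$ the number operator. The Berezin trace $\operatorname{T}:\Lambda(V\oplus V)\to\mathbb{R}$ takes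 the coefficient of $$\omega=\pi^{n/2}(-1)^{n(n+1)/2}\,e_1\wedge\dots\wedge e_n\wedge\hat e_1\wedge\dots\wedge\hat e_n .$$ Let $\mathfrak{so}(V)$ be the skew-symmetric $n\times n$ matrices with $\|A\|^2=\sum_{i<j}A_{ij}^2$ and the corresponding Lebesgue measure $dA=\prod_{i<j}dA_{ij}$, and let $\lambda:\mathfrak{so}(V)\to\operatorname{End}\Lambda V$ be the representation by derivations extending the action on $V$. Put $\dim Q=n+\tfrac{n(n-1)}{2}$. Let $F$ be a finite-dimensional real or complex vector space; $\operatorname{Str}$, $\operatorname{T}$ and $\sigma_k$ are extended to the tensor products with $\operatorname{End}F$ by $\operatorname{Str}\otimes\operatorname{Tr}$, $\operatorname{T}\otimes\operatorname{Tr}$ and $\sigma_k\otimes\operatorname{Id}$. **Proposition.** Let $i\ge 0$ be an integer and let $\phi:\mathfrak{so}(V)\to C^{4i}(V,-V)\otimes\operatorname{End}F$ be smooth with compact support. Then the following limit exists, and $$\lim_{t\to0^+}(4\pi t)^{-\dim Q/2}\,t^{i}\int_{\mathfrak{so}(V)}e^{-\|A\|^2/4t}\operatorname{Str}\bigl[\phi(A)\exp(-\lambda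 A)\bigr]\,dA=\operatorname{T}\Bigl(\exp\bigl(-\tfrac12\textstyle\sum_{k<l}e_k\wedge e_l\wedge\hat e_k\wedge\hat e_l\bigr)\wedge(\sigma_{4i}\phi)(0)\Bigr).$$ -/

import Mathlib

open scoped TensorProduct ContDiff Topology

noncomputable section

namespace GaussianSupertrace

/-! ### The spaces `V`, `V ⊕ V`, the Clifford algebra `C(V,-V)` and its filtration -/

/-- The underlying vector space of `V = ℝⁿ`. -/
abbrev V (n : ℕ) : Type := Fin n → ℝ

/-- The underlying vector space of `V ⊕ V`. -/
abbrev VV (n : ℕ) : Type := V n × V n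

/-- The basis vector `e_i = (e_i, 0)` of `V ⊕ V`. -/
def e {n : ℕ} (i : Fin n) : VV n := (Pi.single i 1, 0)

/-- The basis vector `ê_i = (0, e_i)` of `V ⊕ V`. -/
def eHat {n : ℕ} (i : Fin n) : VV n := (0, Pi.single i 1)

/-- The quadratic form of `(V,-V)`: `q(v,w) = |v|² - |w|²`. -/
def splitForm (n : ℕ) : QuadraticForm ℝ (VV n) :=
  (QuadraticMap.weightedSumSquares ℝ (fun _ : Fin n => (1 : ℝ))).prod
    (QuadraticMap.weightedSumSquares ℝ (fun _ : Fin n => (-1 : ℝ)))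

theorem splitForm_apply {n : ℕ} (x : VV n) :
    splitForm n x = x.1 ⬝ᵥ x.1 - x.2 ⬝ᵥ x.2 := by
  simp [splitForm, QuadraticMap.prod_apply, QuadraticMap.weightedSumSquares_apply, dotProduct,
    sub_eq_add_neg]

/-- The Clifford algebra `C(V,-V)`, with the convention `x · x = -q(x)`, that is
`x · y + y · x = -2 q(x,y)`. Mathlib's `CliffordAlgebra Q` has `x · x = Q(x)`, whence the sign. -/
abbrev Cl (n : ℕ) : Type := CliffordAlgebra (-splitForm n)

/-- The filtration `C^k(V,-V) = ⟨x_1 · … · x_l : x_j ∈ V ⊕ V, l ≤ k⟩`. -/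
def cliffordFiltration (n k : ℕ) : Submodule ℝ (Cl n) :=
  Submodule.span ℝ {a | ∃ l : List (VV n), l.length ≤ k ∧
    a = (l.map (CliffordAlgebra.ι (-splitForm n))).prod}

/-! ### The symbol map -/

/-- The `k`-th symbol map `σ_k : C^k(V,-V) → Λ^k(V ⊕ V) ⊆ Λ(V ⊕ V)`: the degree `k` part of the
image under the canonical linear isomorphism `C(V,-V) ≅ Λ(V ⊕ V)`. See `symbol_prod` and
`symbol_prod_of_lt` for its values on products of vectors. -/
def symbol (n k : ℕ) : cliffordFiltration n k →ₗ[ℝ] ExteriorAlgebra ℝ (VV n) :=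
  GradedAlgebra.proj (fun j : ℕ => ⋀[ℝ]^j (VV n)) k ∘ₗ
    (CliffordAlgebra.equivExterior (-splitForm n)).toLinearMap ∘ₗ
    (cliffordFiltration n k).subtype

theorem prod_mem_cliffordFiltration {n k : ℕ} (l : List (VV n)) (hl : l.length ≤ k) :
    (l.map (CliffordAlgebra.ι (-splitForm n))).prod ∈ cliffordFiltration n k :=
  Submodule.subset_span ⟨l, hl, rfl⟩

/-- The part of the exterior algebra of degree `< k`. -/
def exteriorLT (n k : ℕ) : Submodule ℝ (ExteriorAlgebra ℝ (VV n)) :=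
  Submodule.span ℝ {a | ∃ l : List (VV n), l.length < k ∧
    a = (l.map (ExteriorAlgebra.ι ℝ)).prod}

theorem prod_mem_exteriorPower {n : ℕ} (l : List (VV n)) :
    (l.map (ExteriorAlgebra.ι ℝ)).prod ∈ ⋀[ℝ]^l.length (VV n) := by
  induction l with
  | nil => simp
  | cons a l ih =>
    rw [List.map_cons, List.prod_cons, List.length_cons]
    change _ ∈ LinearMap.range (ExteriorAlgebra.ι ℝ : VV n →ₗ[ℝ] _) ^ (l.length + 1)
    rw [pow_succ']
    exact Submodule.mul_mem_mul (LinearMap.mem_range_self _ a) ih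

theorem ι_mul_mem_exteriorLT {n k : ℕ} (a : VV n) {x : ExteriorAlgebra ℝ (VV n)}
    (hx : x ∈ exteriorLT n k) : ExteriorAlgebra.ι ℝ a * x ∈ exteriorLT n (k + 1) := by
  induction hx using Submodule.span_induction with
  | mem x h =>
    obtain ⟨l, hl, rfl⟩ := h
    exact Submodule.subset_span ⟨a :: l, by simpa using hl, by simp⟩
  | zero => simp
  | add x y _ _ hx hy => rw [mul_add]; exact add_mem hx hy
  | smul r x _ hx => rw [mul_smul_comm]; exact Submodule.smul_mem _ r hx

theorem contractLeft_prod_mem {n : ℕ} (d : Module.Dual ℝ (VV n)) (l : List (VV n)) :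
    CliffordAlgebra.contractLeft d ((l.map (ExteriorAlgebra.ι ℝ)).prod :
      ExteriorAlgebra ℝ (VV n)) ∈ exteriorLT n l.length := by
  induction l with
  | nil => simp
  | cons a l ih =>
    rw [List.map_cons, List.prod_cons, ExteriorAlgebra.ι, CliffordAlgebra.contractLeft_ι_mul]
    refine sub_mem (Submodule.smul_mem _ _ (Submodule.subset_span ⟨l, by simp, rfl⟩)) ?_
    exact ι_mul_mem_exteriorLT a ih

theorem contractLeft_mem {n k : ℕ} (d : Module.Dual ℝ (VV n)) {x : ExteriorAlgebra ℝ (VV n)}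
    (hx : x ∈ exteriorLT n k) : CliffordAlgebra.contractLeft d x ∈ exteriorLT n k := by
  induction hx using Submodule.span_induction with
  | mem x h =>
    obtain ⟨l, hl, rfl⟩ := h
    refine Submodule.span_mono ?_ (contractLeft_prod_mem d l)
    rintro _ ⟨l', hl', rfl⟩
    exact ⟨l', hl'.trans hl, rfl⟩
  | zero => simp
  | add x y _ _ hx hy => rw [map_add]; exact add_mem hx hy
  | smul r x _ hx => rw [map_smul]; exact Submodule.smul_mem _ r hx

theorem equivExterior_prod_sub_mem {n : ℕ} (l : List (VV n)) :
    CliffordAlgebra.equivExterior (-splitForm n)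
        (l.map (CliffordAlgebra.ι (-splitForm n))).prod
      - (l.map (ExteriorAlgebra.ι ℝ)).prod ∈ exteriorLT n l.length := by
  induction l with
  | nil =>
    have h : CliffordAlgebra.equivExterior (-splitForm n) 1 = 1 :=
      CliffordAlgebra.changeForm_one CliffordAlgebra.changeForm.associated_neg_proof
    simp only [List.map_nil, List.prod_nil, h, sub_self]
    exact zero_mem _
  | cons a l ih =>
    set X := CliffordAlgebra.equivExterior (-splitForm n)
        (l.map (CliffordAlgebra.ι (-splitForm n))).prod with hX
    have h : CliffordAlgebra.equivExterior (-splitForm n)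
        (CliffordAlgebra.ι (-splitForm n) a *
          (l.map (CliffordAlgebra.ι (-splitForm n))).prod) =
        ExteriorAlgebra.ι ℝ a * X - CliffordAlgebra.contractLeft
          ((QuadraticMap.associated (R := ℝ) (M := VV n) (-(-splitForm n))) a) X :=
      CliffordAlgebra.changeForm_ι_mul CliffordAlgebra.changeForm.associated_neg_proof _ _
    rw [List.map_cons, List.prod_cons, List.map_cons, List.prod_cons, h, List.length_cons,
      sub_right_comm, ← mul_sub]
    refine sub_mem (ι_mul_mem_exteriorLT a ih) (contractLeft_mem _ ?_)
    rw [← sub_add_cancel X (l.map (ExteriorAlgebra.ι ℝ)).prod]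
    refine add_mem (Submodule.span_mono ?_ ih) (Submodule.subset_span ⟨l, by simp, rfl⟩)
    rintro _ ⟨l', hl', rfl⟩
    exact ⟨l', hl'.trans (Nat.lt_succ_self _), rfl⟩

theorem proj_exteriorLT {n j k : ℕ} (hjk : j ≤ k) {x : ExteriorAlgebra ℝ (VV n)}
    (hx : x ∈ exteriorLT n j) :
    GradedAlgebra.proj (fun j : ℕ => ⋀[ℝ]^j (VV n)) k x = 0 := by
  induction hx using Submodule.span_induction with
  | mem x h =>
    obtain ⟨l, hl, rfl⟩ := h
    rw [GradedAlgebra.proj_apply]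
    exact DirectSum.decompose_of_mem_ne (fun j : ℕ => ⋀[ℝ]^j (VV n)) (prod_mem_exteriorPower l)
      (by omega)
  | zero => simp
  | add x y _ _ hx hy => rw [map_add, hx, hy, add_zero]
  | smul r x _ hx => rw [map_smul, hx, smul_zero]

/-- `σ_k(x_1 · … · x_k) = x_1 ∧ … ∧ x_k`. -/
theorem symbol_prod {n : ℕ} (l : List (VV n)) :
    symbol n l.length ⟨_, prod_mem_cliffordFiltration l le_rfl⟩ =
      (l.map (ExteriorAlgebra.ι ℝ)).prod := by
  have h := proj_exteriorLT le_rfl (equivExterior_prod_sub_mem l)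
  rw [map_sub, sub_eq_zero] at h
  refine h.trans ?_
  rw [GradedAlgebra.proj_apply]
  exact DirectSum.decompose_of_mem_same (fun j : ℕ => ⋀[ℝ]^j (VV n)) (prod_mem_exteriorPower l)

/-- `σ_k` vanishes on `C^{k-1}(V,-V)`. -/
theorem symbol_prod_of_lt {n k : ℕ} (l : List (VV n)) (hl : l.length < k) :
    symbol n k ⟨_, prod_mem_cliffordFiltration l hl.le⟩ = 0 := by
  have h := proj_exteriorLT hl.le (equivExterior_prod_sub_mem l)
  rw [map_sub, sub_eq_zero] at h
  refine h.trans ?_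
  rw [GradedAlgebra.proj_apply]
  exact DirectSum.decompose_of_mem_ne (fun j : ℕ => ⋀[ℝ]^j (VV n)) (prod_mem_exteriorPower l) hl.ne

/-! ### The action of `C(V,-V)` on `ΛV` and the supertrace -/

/-- `End ΛV`. -/
abbrev EndExt (n : ℕ) : Type := Module.End ℝ (ExteriorAlgebra ℝ (V n))

/-- Exterior multiplication `ε(v)` on `ΛV`. -/
def extMul {n : ℕ} : V n →ₗ[ℝ] EndExt n :=
  LinearMap.mul ℝ (ExteriorAlgebra ℝ (V n)) ∘ₗ ExteriorAlgebra.ι ℝ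

/-- Interior multiplication `ι(v)` on `ΛV`, the contraction with `⟨v, ·⟩`. -/
def intMul {n : ℕ} : V n →ₗ[ℝ] EndExt n :=
  CliffordAlgebra.contractLeft ∘ₗ (dotProductEquiv ℝ (Fin n)).toLinearMap

theorem extMul_mul_self {n : ℕ} (v : V n) : extMul v * extMul v = 0 := by
  ext x
  simp [extMul, ← mul_assoc]

theorem intMul_mul_self {n : ℕ} (v : V n) : intMul v * intMul v = 0 := by
  refine LinearMap.ext fun x => ?_
  simp [intMul, CliffordAlgebra.contractLeft_contractLeft]

theorem intMul_mul_extMul {n : ℕ} (v w : V n) :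
    intMul v * extMul w = (v ⬝ᵥ w) • (1 : EndExt n) - extMul w * intMul v := by
  refine LinearMap.ext fun x => ?_
  exact CliffordAlgebra.contractLeft_ι_mul (Q := (0 : QuadraticForm ℝ (V n)))
    (d := dotProductEquiv ℝ (Fin n) v) w x

/-- The map `(v,w) ↦ c(v) + ĉ(w)` with `c(v) = ε(v) - ι(v)` and `ĉ(w) = ε(w) + ι(w)`. -/
def cliffordGenerators (n : ℕ) : VV n →ₗ[ℝ] EndExt n :=
  (extMul - intMul) ∘ₗ LinearMap.fst ℝ (V n) (V n) +
    (extMul + intMul) ∘ₗ LinearMap.snd ℝ (V n) (V n)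

theorem cliffordGenerators_mul_self {n : ℕ} (x : VV n) :
    cliffordGenerators n x * cliffordGenerators n x =
      algebraMap ℝ (EndExt n) ((-splitForm n) x) := by
  have h : cliffordGenerators n x = extMul (x.1 + x.2) + intMul (x.2 - x.1) := by
    simp only [cliffordGenerators, LinearMap.add_apply, LinearMap.comp_apply, LinearMap.sub_apply,
      LinearMap.fst_apply, LinearMap.snd_apply, map_add, map_sub]
    abel
  rw [h, add_mul, mul_add, mul_add, extMul_mul_self, intMul_mul_self, intMul_mul_extMul,
    Algebra.algebraMap_eq_smul_one]
  have h2 : (x.2 - x.1) ⬝ᵥ (x.1 + x.2) = (-splitForm n) x := by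
    rw [neg_apply, splitForm_apply, sub_dotProduct, dotProduct_add, dotProduct_add,
      dotProduct_comm x.2 x.1]
    ring
  rw [h2]
  abel

/-- The representation `c ⊗ ĉ : C(V,-V) → End ΛV`. -/
def cliffordAction (n : ℕ) : Cl n →ₐ[ℝ] EndExt n :=
  CliffordAlgebra.lift (-splitForm n) ⟨cliffordGenerators n, cliffordGenerators_mul_self⟩

/-- The canonical supertrace `Str T = Tr((-1)^N T)` on `End ΛV`; the involution
`CliffordAlgebra.involute` of `ΛV` is `(-1)^N`, with `N` the number operator. -/
def supertrace (n : ℕ) : EndExt n →ₗ[ℝ] ℝ :=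
  LinearMap.trace ℝ (ExteriorAlgebra ℝ (V n)) ∘ₗ
    LinearMap.mulLeft ℝ (CliffordAlgebra.involute.toLinearMap : EndExt n)

/-- The extension `ℓ ⊗ Tr : W ⊗ End F → 𝕜` of a linear functional `ℓ` on `W`. -/
def tensorTrace {W : Type*} [AddCommGroup W] [Module ℝ W] (𝕜 F : Type*) [RCLike 𝕜]
    [AddCommGroup F] [Module 𝕜 F] [Module ℝ F] [IsScalarTower ℝ 𝕜 F] (ℓ : W →ₗ[ℝ] ℝ) :
    W ⊗[ℝ] Module.End 𝕜 F →ₗ[ℝ] 𝕜 :=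
  (TensorProduct.lid ℝ 𝕜).toLinearMap ∘ₗ
    TensorProduct.map ℓ ((LinearMap.trace 𝕜 F).restrictScalars ℝ)

/-! ### The Berezin trace -/

/-- The basis `e_1, …, e_n, ê_1, …, ê_n` of `V ⊕ V`. -/
def basisVV (n : ℕ) : Module.Basis (Fin (n + n)) ℝ (VV n) :=
  ((Pi.basisFun ℝ (Fin n)).prod (Pi.basisFun ℝ (Fin n))).reindex finSumFinEquiv

/-- The volume element
`ω = π^{n/2} (-1)^{n(n+1)/2} e_1 ∧ … ∧ e_n ∧ ê_1 ∧ … ∧ ê_n` in `Λ(V ⊕ V)`. -/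
def volumeElement (n : ℕ) : ExteriorAlgebra ℝ (VV n) :=
  (Real.pi ^ ((n : ℝ) / 2) * (-1) ^ (n * (n + 1) / 2)) •
    ((List.ofFn fun i : Fin n => ExteriorAlgebra.ι ℝ (e i)).prod *
      (List.ofFn fun i : Fin n => ExteriorAlgebra.ι ℝ (eHat i)).prod)

/-- The Berezin trace `T : Λ(V ⊕ V) → ℝ`, the coefficient of the volume element `ω`: the functional
that vanishes in degrees other than `2n` and maps `x_1 ∧ … ∧ x_{2n}` to
`π^{-n/2} (-1)^{n(n+1)/2}` times the determinant of `(x_1, …, x_{2n})` with respect to the basis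
`e_1, …, e_n, ê_1, …, ê_n`. -/
def berezin (n : ℕ) : ExteriorAlgebra ℝ (VV n) →ₗ[ℝ] ℝ :=
  (Real.pi ^ (-(n : ℝ) / 2) * (-1) ^ (n * (n + 1) / 2)) •
    ExteriorAlgebra.liftAlternating (Pi.single (n + n) (basisVV n).det)

theorem berezin_volumeElement (n : ℕ) : berezin n (volumeElement n) = 1 := by
  have h : (List.ofFn fun i : Fin n => ExteriorAlgebra.ι ℝ (e i)).prod *
      (List.ofFn fun i : Fin n => ExteriorAlgebra.ι ℝ (eHat i)).prod =
      ExteriorAlgebra.ιMulti ℝ (n + n) (basisVV n) := by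
    rw [ExteriorAlgebra.ιMulti_apply, ← List.prod_append, ← List.ofFn_fin_append]
    congr 2
    funext i
    refine Fin.addCases (fun j => ?_) (fun j => ?_) i
    · rw [Fin.append_left, basisVV, Module.Basis.reindex_apply, finSumFinEquiv_symm_apply_castAdd]
      simp [e]
    · rw [Fin.append_right, basisVV, Module.Basis.reindex_apply, finSumFinEquiv_symm_apply_natAdd]
      simp [eHat]
  rw [volumeElement, h, map_smul, berezin, LinearMap.smul_apply,
    ExteriorAlgebra.liftAlternating_apply_ιMulti, Pi.single_eq_same, Module.Basis.det_self,
    smul_eq_mul, smul_eq_mul, mul_one, mul_mul_mul_comm, ← Real.rpow_add Real.pi_pos,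
    ← mul_pow]
  norm_num [← add_div]

theorem berezin_ιMulti_of_ne {n k : ℕ} (hk : k ≠ n + n) (x : Fin k → VV n) :
    berezin n (ExteriorAlgebra.ιMulti ℝ k x) = 0 := by
  simp [berezin, ExteriorAlgebra.liftAlternating_apply_ιMulti, Pi.single_eq_of_ne hk]

/-! ### The Lie algebra `so(V)` -/

/-- The Lie algebra `so(V)` of skew-symmetric real `n × n` matrices. -/
abbrev SO (n : ℕ) : Type := LieAlgebra.Orthogonal.so (Fin n) ℝ

/-- The pairs `i < j`. -/
abbrev Pairs (n : ℕ) : Type := {p : Fin n × Fin n // p.1 < p.2}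

/-- The skew-symmetric matrix `∑_{i<j} x_ij E_ij`, where `E_ij` has entries `1` at `(i,j)`, `-1` at
`(j,i)` and `0` elsewhere. -/
def skewMatrix {n : ℕ} (x : Pairs n → ℝ) : Matrix (Fin n) (Fin n) ℝ :=
  Matrix.of fun i j => if h : i < j then x ⟨(i, j), h⟩ else if h : j < i then -x ⟨(j, i), h⟩ else 0

theorem skewMatrix_lt {n : ℕ} (x : Pairs n → ℝ) {i j : Fin n} (h : i < j) :
    skewMatrix x i j = x ⟨(i, j), h⟩ := by
  rw [skewMatrix, Matrix.of_apply, dif_pos h]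

theorem skewMatrix_gt {n : ℕ} (x : Pairs n → ℝ) {i j : Fin n} (h : j < i) :
    skewMatrix x i j = -x ⟨(j, i), h⟩ := by
  rw [skewMatrix, Matrix.of_apply, dif_neg h.not_gt, dif_pos h]

theorem skewMatrix_self {n : ℕ} (x : Pairs n → ℝ) (i : Fin n) : skewMatrix x i i = 0 := by
  rw [skewMatrix, Matrix.of_apply, dif_neg (lt_irrefl i), dif_neg (lt_irrefl i)]

theorem skewMatrix_mem {n : ℕ} (x : Pairs n → ℝ) :
    skewMatrix x ∈ LieAlgebra.Orthogonal.so (Fin n) ℝ := by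
  rw [LieAlgebra.Orthogonal.mem_so]
  ext i j
  rw [Matrix.transpose_apply, Matrix.neg_apply]
  rcases lt_trichotomy i j with h | h | h
  · rw [skewMatrix_lt x h, skewMatrix_gt x h]
  · rw [h, skewMatrix_self, neg_zero]
  · rw [skewMatrix_lt x h, skewMatrix_gt x h, neg_neg]

/-- The linear isomorphism `ℝ^N ≅ so(V)`, `N = n(n-1)/2`, given by the basis `E_ij`, `i < j`, which is
orthonormal for the inner product `⟨A,B⟩ = ∑_{i<j} A_ij B_ij` on `so(V)`. -/
def soEquiv (n : ℕ) : EuclideanSpace ℝ (Pairs n) ≃ₗ[ℝ] SO n where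
  toFun x := ⟨skewMatrix x.ofLp, skewMatrix_mem _⟩
  map_add' x y := by
    refine Subtype.ext (Matrix.ext fun i j => ?_)
    change skewMatrix (x + y).ofLp i j = skewMatrix x.ofLp i j + skewMatrix y.ofLp i j
    rcases lt_trichotomy i j with h | h | h
    · simp only [skewMatrix_lt _ h, PiLp.add_apply]
    · subst h; simp only [skewMatrix_self, add_zero]
    · simp only [skewMatrix_gt _ h, PiLp.add_apply, neg_add]
  map_smul' r x := by
    refine Subtype.ext (Matrix.ext fun i j => ?_)
    change skewMatrix (r • x).ofLp i j = r * skewMatrix x.ofLp i j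
    rcases lt_trichotomy i j with h | h | h
    · simp only [skewMatrix_lt _ h, PiLp.smul_apply, smul_eq_mul]
    · subst h; simp only [skewMatrix_self, mul_zero]
    · simp only [skewMatrix_gt _ h, PiLp.smul_apply, smul_eq_mul, mul_neg]
  invFun A := WithLp.toLp 2 fun p => A.1 p.1.1 p.1.2
  left_inv x := by
    ext p
    exact skewMatrix_lt _ p.2
  right_inv A := by
    have hA := (LieAlgebra.Orthogonal.mem_so (Fin n) ℝ A.1).1 A.2
    have hA' : ∀ i j, A.1 j i = -A.1 i j := fun i j => congrFun (congrFun hA i) j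
    refine Subtype.ext (Matrix.ext fun i j => ?_)
    rcases lt_trichotomy i j with h | h | h
    · exact skewMatrix_lt _ h
    · subst h
      refine (skewMatrix_self _ i).trans ?_
      have := hA' i i
      linarith
    · exact (skewMatrix_gt _ h).trans (hA' j i).symm

/-- `‖A‖² = ∑_{i<j} A_ij²`. -/
def soNormSq {n : ℕ} (A : SO n) : ℝ := ∑ p : Pairs n, A.1 p.1.1 p.1.2 ^ 2

theorem soNormSq_soEquiv {n : ℕ} (x : EuclideanSpace ℝ (Pairs n)) :
    soNormSq (soEquiv n x) = ‖x‖ ^ 2 := by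
  rw [EuclideanSpace.norm_sq_eq]
  exact Finset.sum_congr rfl fun p _ => by
    rw [Real.norm_eq_abs, sq_abs]
    exact congrArg (· ^ 2) (skewMatrix_lt _ p.2)

/-- The integral `∫_{so(V)} f(A) dA` with respect to Lebesgue measure of the inner product on
`so(V)`. -/
def soIntegral {E : Type*} [NormedAddCommGroup E] [NormedSpace ℝ E] {n : ℕ} (f : SO n → E) : E :=
  ∫ x : EuclideanSpace ℝ (Pairs n), f (soEquiv n x)

/-- Smoothness of a map from `so(V)` to a finite-dimensional real vector space `W`: all its
coordinates, equivalently all `ℓ ∘ φ` with `ℓ` a linear functional on `W`, are smooth functions of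
the coordinates `A_ij`, `i < j`. -/
def SmoothOnSO {n : ℕ} {W : Type*} [AddCommGroup W] [Module ℝ W] (φ : SO n → W) : Prop :=
  ∀ ℓ : Module.Dual ℝ W, ContDiff ℝ ∞ fun x : EuclideanSpace ℝ (Pairs n) => ℓ (φ (soEquiv n x))

/-- The representation `λ : so(V) → End ΛV`, by which `A` acts as the derivation of `ΛV` that
extends the action of `A` on `V`: `λA = ∑_j ε(A e_j) ι(e_j)`. -/
def soAction {n : ℕ} (A : SO n) : EndExt n :=
  ∑ j : Fin n, extMul (A.1.mulVec (Pi.single j 1)) * intMul (Pi.single j 1)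

theorem soAction_one {n : ℕ} (A : SO n) : soAction A 1 = 0 := by
  simp [soAction, intMul]

theorem soAction_ι_mul {n : ℕ} (A : SO n) (v : V n) (x : ExteriorAlgebra ℝ (V n)) :
    soAction A (ExteriorAlgebra.ι ℝ v * x) =
      ExteriorAlgebra.ι ℝ (A.1.mulVec v) * x + ExteriorAlgebra.ι ℝ v * soAction A x := by
  have key : ∀ j : Fin n, (extMul (A.1.mulVec (Pi.single j 1)) * intMul (Pi.single j 1))
      (ExteriorAlgebra.ι ℝ v * x) =
      ExteriorAlgebra.ι ℝ (v j • A.1.mulVec (Pi.single j 1)) * x + ExteriorAlgebra.ι ℝ v *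
        (extMul (A.1.mulVec (Pi.single j 1)) * intMul (Pi.single j 1)) x := by
    intro j
    have h := LinearMap.congr_fun (intMul_mul_extMul (Pi.single j 1) v) x
    have h1 : intMul (Pi.single j 1) (ExteriorAlgebra.ι ℝ v * x) =
        v j • x - ExteriorAlgebra.ι ℝ v * intMul (Pi.single j 1) x := by
      simpa [extMul] using h
    have h2 : ExteriorAlgebra.ι ℝ (A.1.mulVec (Pi.single j 1)) * ExteriorAlgebra.ι ℝ v =
        -(ExteriorAlgebra.ι ℝ v * ExteriorAlgebra.ι ℝ (A.1.mulVec (Pi.single j 1))) :=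
      eq_neg_of_add_eq_zero_left (ExteriorAlgebra.ι_add_mul_swap _ _)
    change ExteriorAlgebra.ι ℝ (A.1.mulVec (Pi.single j 1)) *
        intMul (Pi.single j 1) (ExteriorAlgebra.ι ℝ v * x) = _ + ExteriorAlgebra.ι ℝ v *
        (ExteriorAlgebra.ι ℝ (A.1.mulVec (Pi.single j 1)) * intMul (Pi.single j 1) x)
    rw [h1, mul_sub, ← mul_assoc, h2, map_smul, mul_smul_comm, smul_mul_assoc, neg_mul, mul_assoc,
      sub_neg_eq_add]
  have hv : ∑ j : Fin n, v j • A.1.mulVec (Pi.single j 1) = A.1.mulVec v := by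
    simp only [← Matrix.mulVec_smul, ← Matrix.mulVec_sum]
    congr 1
    ext k
    simp [Finset.sum_apply, Pi.single_apply]
  rw [soAction, LinearMap.sum_apply, LinearMap.sum_apply, Finset.sum_congr rfl fun j _ => key j,
    Finset.sum_add_distrib, ← Finset.sum_mul, ← map_sum, hv, Finset.mul_sum]

/-! ### Exponentials -/

/-- The exponential `exp a = ∑_k a^k / k!` in a finite-dimensional real algebra, the series being
taken in the canonical topology of a finite-dimensional real vector space. -/
def algExp {A : Type*} [Ring A] [Algebra ℝ A] (a : A) : A :=
  letI := moduleTopology ℝ A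
  ∑' k : ℕ, ((k.factorial : ℝ)⁻¹) • a ^ k

/-- The element `∑_{i<j} e_i ∧ e_j ∧ ê_i ∧ ê_j` of `Λ(V ⊕ V)`. -/
def quarticElement (n : ℕ) : ExteriorAlgebra ℝ (VV n) :=
  ∑ p : Pairs n, ExteriorAlgebra.ι ℝ (e p.1.1) * ExteriorAlgebra.ι ℝ (e p.1.2) *
    ExteriorAlgebra.ι ℝ (eHat p.1.1) * ExteriorAlgebra.ι ℝ (eHat p.1.2)

/-- `Str[φ exp(-λA)]` for `φ ∈ C^k(V,-V) ⊗ End F`, where `C(V,-V)` acts on `ΛV` through `c ⊗ ĉ`. -/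
def strExp {n k : ℕ} {𝕜 F : Type*} [RCLike 𝕜] [AddCommGroup F] [Module 𝕜 F] [Module ℝ F]
    [IsScalarTower ℝ 𝕜 F] (a : cliffordFiltration n k ⊗[ℝ] Module.End 𝕜 F) (A : SO n) : 𝕜 :=
  tensorTrace 𝕜 F (supertrace n)
    (((cliffordAction n).toLinearMap ∘ₗ (cliffordFiltration n k).subtype).rTensor
        (Module.End 𝕜 F) a *
      (algExp (-soAction A) ⊗ₜ[ℝ] (1 : Module.End 𝕜 F)))

end GaussianSupertrace

end

noncomputable section

namespace GaussianSupertrace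

/-! The proof is Getzler rescaling on the Clifford filtration. The supertrace on `End ΛV` sees only
the top degree: `Str(a)` is `(4π)^{n/2}` times the Berezin trace of the exterior form of `a`
(`supertrace_cliffordAction`). A Clifford monomial in basis vectors missing one of them has
supertrace zero, and the product of all the `ê_i e_i` acts as `(-1)^N`, so the top monomial has
supertrace `±2^n`.

Since `λ(E_kl) = ½(ê_k ê_l - e_k e_l)` has Clifford order 2, the term of degree `m` of `Str[b
exp(-λA)]`, `b` of order `4i`, comes from an element of order `4i + 2m`. It vanishes for `2i + m <
n`, and for `2i + m = n` it depends only on symbols. Put `s = √t` and `A = s y`. The Gaussian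
becomes `exp(-‖y‖²/4)`, and Jacobian and normalization leave a constant times `s^{2i-n}`; the `m`-th
term thus carries `s^{2i+m-n}`. Negative powers have zero coefficient, positive ones tend to zero,
and the term `m = n - 2i` survives. The series is dominated by `C exp(M‖y‖)` for `s ≤ 1`, so limit
and integral commute, and the compactly supported factor tends to its value at `0`.

What remains is the Gaussian integral of `exp(-∑ y_p a_p)` with `a_p = ½(ê_k ∧ ê_l - e_k ∧ e_l)`.
These elements are central with `a_p³ = 0`, so the integral factors over pairs: `∫ e^{-y²/4}(1 - y a
+ y²a²/2) dy = √(4π)(1 + a²) = √(4π) exp(a²)` (`integral_gaussian_algExp`). As `a_p² = -½ e_k ∧ e_l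
∧ ê_k ∧ ê_l`, the quartic exponential appears, and the powers of `4π` cancel because `dim Q` is `n`
plus the number of pairs. Coefficients in `End F` are handled by a basis of the finite-dimensional
space `C^{4i}(V,-V)`. -/

/-! ### The parity involution of `ΛV` -/

/-- The involution `(-1)^N` of `ΛV`. -/
def parity (n : ℕ) : EndExt n := CliffordAlgebra.involute.toLinearMap

theorem supertrace_apply {n : ℕ} (a : EndExt n) :
    supertrace n a = LinearMap.trace ℝ (ExteriorAlgebra ℝ (V n)) (parity n * a) := rfl

instance exteriorAlgebra_finite (n : ℕ) : Module.Finite ℝ (ExteriorAlgebra ℝ (V n)) :=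
  .of_basis (Pi.basisFun ℝ (Fin n)).ExteriorAlgebra

theorem finrank_exteriorAlgebra (n : ℕ) : Module.finrank ℝ (ExteriorAlgebra ℝ (V n)) = 2 ^ n := by
  rw [Module.finrank_eq_card_basis (Pi.basisFun ℝ (Fin n)).ExteriorAlgebra, Fintype.card_finset,
    Fintype.card_fin]

theorem parity_mul_extMul {n : ℕ} (v : V n) : parity n * extMul v = -(extMul v * parity n) := by
  refine LinearMap.ext fun x => ?_
  change CliffordAlgebra.involute (CliffordAlgebra.ι _ v * x) =
    -(CliffordAlgebra.ι _ v * CliffordAlgebra.involute x)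
  rw [map_mul, CliffordAlgebra.involute_ι, neg_mul]

/-- Contraction lowers the degree by one, hence reverses parity. -/
theorem involute_contractLeft {R M : Type*} [CommRing R] [AddCommGroup M] [Module R M]
    {Q : QuadraticForm R M} (d : Module.Dual R M) (x : CliffordAlgebra Q) :
    CliffordAlgebra.involute (CliffordAlgebra.contractLeft d x) =
      -CliffordAlgebra.contractLeft d (CliffordAlgebra.involute x) := by
  induction x using CliffordAlgebra.left_induction with
  | algebraMap r => simp [CliffordAlgebra.contractLeft_algebraMap]
  | add x y hx hy => simp only [map_add, hx, hy, neg_add]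
  | ι_mul x m hx =>
    simp only [CliffordAlgebra.contractLeft_ι_mul, map_sub, map_smul, map_mul,
      CliffordAlgebra.involute_ι, hx, neg_mul, map_neg]
    simp

theorem parity_mul_intMul {n : ℕ} (v : V n) : parity n * intMul v = -(intMul v * parity n) :=
  LinearMap.ext fun x => involute_contractLeft _ x

theorem parity_mul_cliffordGenerators {n : ℕ} (v : VV n) :
    parity n * cliffordGenerators n v = -(cliffordGenerators n v * parity n) := by
  simp only [cliffordGenerators, LinearMap.add_apply, LinearMap.comp_apply, LinearMap.sub_apply,
    mul_add, mul_sub, add_mul, sub_mul, parity_mul_extMul, parity_mul_intMul]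
  abel

theorem parity_mul_parity (n : ℕ) : parity n * parity n = 1 :=
  LinearMap.ext fun x => CliffordAlgebra.involute_involute x

/-- `ΛV` is generated from `1` by exterior multiplications, so these two properties determine
`(-1)^N`. They serve to recognise it in a product of Clifford generators. -/
theorem parity_eq_of_extMul {n : ℕ} {P : EndExt n} (h1 : P 1 = 1)
    (h : ∀ v, P * extMul v = -(extMul v * P)) : P = parity n := by
  refine LinearMap.ext fun x => ?_
  induction x using CliffordAlgebra.left_induction with
  | algebraMap r =>
    rw [Algebra.algebraMap_eq_smul_one, map_smul, map_smul]
    congr 1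
    exact h1.trans (map_one CliffordAlgebra.involute).symm
  | add x y hx hy => rw [map_add, map_add, hx, hy]
  | ι_mul x m hx =>
    have h2 := LinearMap.congr_fun (h m) x
    have h3 := LinearMap.congr_fun (parity_mul_extMul m) x
    refine h2.trans (Eq.trans ?_ h3.symm)
    simp only [LinearMap.neg_apply, Module.End.mul_apply, hx]

/-! ### Products of anticommuting elements -/

theorem list_prod_mul_of_anticomm {R : Type*} [Ring R] [Algebra ℝ R] {f : R} :
    ∀ l : List R, (∀ x ∈ l, f * x = -(x * f)) →
      f * l.prod = (-1 : ℝ) ^ l.length • (l.prod * f)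
  | [], _ => by simp
  | a :: l, h => by
    have h1 := h a (by simp)
    have h2 := list_prod_mul_of_anticomm l fun x hx => h x (by simp [hx])
    rw [List.prod_cons, ← mul_assoc, h1, neg_mul, mul_assoc, h2, List.length_cons, pow_succ,
      mul_neg_one, neg_smul, mul_smul_comm, mul_assoc]

/-- Each `b j` moves left past all `a i` with `i ≥ j`: `n + (n-1) + … + 1` sign changes. -/
theorem ofFn_prod_mul_ofFn_prod {R : Type*} [Ring R] [Algebra ℝ R] : ∀ {n : ℕ} (a b : Fin n → R),
    (∀ i j, b i * a j = -(a j * b i)) → (List.ofFn a).prod * (List.ofFn b).prod =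
      (-1 : ℝ) ^ (n * (n + 1) / 2) • (List.ofFn fun i => b i * a i).prod
  | 0, a, b, _ => by simp
  | n + 1, a, b, h => by
    have ih := ofFn_prod_mul_ofFn_prod (fun i => a i.succ) (fun i => b i.succ)
      fun i j => h i.succ j.succ
    have h1 : b 0 * (List.ofFn fun i : Fin n => a i.succ).prod =
        (-1 : ℝ) ^ n • ((List.ofFn fun i : Fin n => a i.succ).prod * b 0) := by
      have := list_prod_mul_of_anticomm (f := b 0) (List.ofFn fun i : Fin n => a i.succ)
        fun x hx => by
          obtain ⟨i, rfl⟩ := (List.mem_ofFn' _ _).1 hx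
          exact h 0 i.succ
      rwa [List.length_ofFn] at this
    have h2 : (List.ofFn fun i : Fin n => a i.succ).prod * b 0 =
        (-1 : ℝ) ^ n • (b 0 * (List.ofFn fun i : Fin n => a i.succ).prod) := by
      rw [h1, smul_smul, ← mul_pow, neg_one_mul, neg_neg, one_pow, one_smul]
    -- Of the `n + 1` new signs, `n` move `b 0` past the remaining `a`'s and one turns `a 0 * b 0`
    -- into `b 0 * a 0`.
    have h3 : (n + 1) * (n + 1 + 1) / 2 = n * (n + 1) / 2 + n + 1 := by
      rw [show (n + 1) * (n + 1 + 1) = n * (n + 1) + 2 * (n + 1) by ring,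
        Nat.add_mul_div_left _ _ (by norm_num)]
      rfl
    simp only [List.ofFn_succ, List.prod_cons]
    calc a 0 * (List.ofFn fun i : Fin n => a i.succ).prod *
          (b 0 * (List.ofFn fun i : Fin n => b i.succ).prod)
        = a 0 * ((List.ofFn fun i : Fin n => a i.succ).prod * b 0) *
          (List.ofFn fun i : Fin n => b i.succ).prod := by simp only [mul_assoc]
      _ = (-1 : ℝ) ^ n • (a 0 * b 0 * ((List.ofFn fun i : Fin n => a i.succ).prod *
          (List.ofFn fun i : Fin n => b i.succ).prod)) := by
        rw [h2, mul_smul_comm, smul_mul_assoc]; simp only [mul_assoc]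
      _ = _ := by
        rw [ih, h3, mul_smul_comm, show a 0 * b 0 = -(b 0 * a 0) by rw [h 0 0, neg_neg],
          smul_smul, neg_mul, smul_neg, ← neg_smul]
        congr 1
        ring

/-! ### The supertrace and the Berezin trace -/

theorem cliffordAction_ι {n : ℕ} (v : VV n) :
    cliffordAction n (CliffordAlgebra.ι (-splitForm n) v) = cliffordGenerators n v :=
  CliffordAlgebra.lift_ι_apply _ _ _

theorem parity_mul_cliffordAction_prod {n : ℕ} (l : List (VV n)) :
    parity n * cliffordAction n (l.map (CliffordAlgebra.ι (-splitForm n))).prod =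
      (-1 : ℝ) ^ l.length •
        (cliffordAction n (l.map (CliffordAlgebra.ι (-splitForm n))).prod * parity n) := by
  have := list_prod_mul_of_anticomm (f := parity n) (l.map (cliffordGenerators n)) (by
    intro x hx
    obtain ⟨v, -, rfl⟩ := List.mem_map.1 hx
    exact parity_mul_cliffordGenerators v)
  rw [List.length_map] at this
  have h2 : cliffordAction n (l.map (CliffordAlgebra.ι (-splitForm n))).prod =
      (l.map (cliffordGenerators n)).prod := by
    rw [map_list_prod, List.map_map]
    exact congrArg _ (List.map_congr_left fun v _ => cliffordAction_ι v)
  rw [h2]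
  exact this

/-- The supertrace of a Clifford product vanishes if some anisotropic vector is orthogonal to all
its factors. -/
theorem supertrace_prod_eq_zero {n : ℕ} {f : VV n} (hf : splitForm n f ≠ 0) (l : List (VV n))
    (h : ∀ w ∈ l, QuadraticMap.polar (-splitForm n) f w = 0) :
    supertrace n (cliffordAction n (l.map (CliffordAlgebra.ι (-splitForm n))).prod) = 0 := by
  set x := cliffordAction n (l.map (CliffordAlgebra.ι (-splitForm n))).prod with hx
  have hp : parity n * x = (-1 : ℝ) ^ l.length • (x * parity n) := parity_mul_cliffordAction_prod l
  have hfx : cliffordGenerators n f * x = (-1 : ℝ) ^ l.length • (x * cliffordGenerators n f) := by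
    have := list_prod_mul_of_anticomm (f := CliffordAlgebra.ι (-splitForm n) f)
      (l.map (CliffordAlgebra.ι (-splitForm n))) (by
        intro y hy
        obtain ⟨w, hw, rfl⟩ := List.mem_map.1 hy
        have := CliffordAlgebra.ι_mul_ι_add_swap (Q := -splitForm n) f w
        rw [h w hw, map_zero] at this
        exact eq_neg_of_add_eq_zero_left this)
    have := congrArg (cliffordAction n) this
    rw [List.length_map, map_mul, map_smul, map_mul,
      cliffordAction_ι] at this
    exact this
  have hff := cliffordGenerators_mul_self f
  rw [supertrace_apply]
  rcases l.length.even_or_odd with he | ho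
  -- Even length: `f` commutes with `x` and anticommutes with the parity, so carrying one `f` around
  -- the trace shows that `Tr((-1)^N x f²)` is its own negative; `f²` is a nonzero scalar.
  · rw [he.neg_one_pow, one_smul] at hfx hp
    have h1 : LinearMap.trace ℝ _ (parity n * x * (cliffordGenerators n f *
        cliffordGenerators n f)) = -LinearMap.trace ℝ _ (parity n * x * (cliffordGenerators n f *
        cliffordGenerators n f)) := by
      conv_lhs => rw [← mul_assoc, LinearMap.trace_mul_comm, mul_assoc, ← mul_assoc,
        ← neg_eq_iff_eq_neg.2 (parity_mul_cliffordGenerators f), neg_mul, mul_assoc]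
      rw [map_neg, ← mul_assoc (cliffordGenerators n f), hfx]
      simp only [mul_assoc]
    have h2 := self_eq_neg.1 h1
    rw [hff, Algebra.algebraMap_eq_smul_one, mul_smul_comm, mul_one, map_smul, smul_eq_mul,
      mul_eq_zero] at h2
    refine h2.resolve_left ?_
    simpa using hf
  -- Odd length: `x` anticommutes with the parity, and cyclicity of the trace suffices.
  · rw [ho.neg_one_pow] at hp
    have h1 : LinearMap.trace ℝ _ (parity n * x) = -LinearMap.trace ℝ _ (parity n * x) := by
      conv_lhs => rw [hp, map_smul, LinearMap.trace_mul_comm, smul_eq_mul, neg_one_mul]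
    exact self_eq_neg.1 h1

/-! ### The orthogonal basis of `V ⊕ V` and its products -/

theorem basisVV_castAdd {n : ℕ} (i : Fin n) : basisVV n (Fin.castAdd n i) = e i := by
  rw [basisVV, Module.Basis.reindex_apply, finSumFinEquiv_symm_apply_castAdd]
  simp [e]

theorem basisVV_natAdd {n : ℕ} (i : Fin n) : basisVV n (Fin.natAdd n i) = eHat i := by
  rw [basisVV, Module.Basis.reindex_apply, finSumFinEquiv_symm_apply_natAdd]
  simp [eHat]

theorem polar_splitForm {n : ℕ} (x y : VV n) :
    QuadraticMap.polar (-splitForm n) x y = 2 * (x.2 ⬝ᵥ y.2) - 2 * (x.1 ⬝ᵥ y.1) := by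
  simp only [QuadraticMap.polar, neg_apply, splitForm_apply, Prod.fst_add, Prod.snd_add,
    add_dotProduct, dotProduct_add]
  rw [dotProduct_comm y.1 x.1, dotProduct_comm y.2 x.2]
  ring

theorem splitForm_basisVV_ne_zero {n : ℕ} (i : Fin (n + n)) : splitForm n (basisVV n i) ≠ 0 := by
  rw [splitForm_apply]
  refine Fin.addCases (fun j => ?_) (fun j => ?_) i
  · simp [basisVV_castAdd, e]
  · rw [basisVV_natAdd]
    simp [eHat]

theorem polar_basisVV {n : ℕ} {i j : Fin (n + n)} (h : i ≠ j) :
    QuadraticMap.polar (-splitForm n) (basisVV n i) (basisVV n j) = 0 := by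
  rw [polar_splitForm]
  revert h
  refine Fin.addCases (fun i => ?_) (fun i => ?_) i <;>
  refine Fin.addCases (fun j => ?_) (fun j => ?_) j <;> intro h
  · have : i ≠ j := fun h' => h (by rw [h'])
    simp [basisVV_castAdd, e, this]
  · rw [basisVV_castAdd, basisVV_natAdd]
    simp [e, eHat]
  · rw [basisVV_castAdd, basisVV_natAdd]
    simp [e, eHat]
  · have : i ≠ j := fun h' => h (by rw [h'])
    rw [basisVV_natAdd, basisVV_natAdd]
    simp [eHat, this]

theorem contractLeft_list_prod_eq_zero {n : ℕ} (d : Module.Dual ℝ (VV n)) :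
    ∀ l : List (VV n), (∀ w ∈ l, d w = 0) →
      CliffordAlgebra.contractLeft d ((l.map (ExteriorAlgebra.ι ℝ)).prod :
        ExteriorAlgebra ℝ (VV n)) = 0
  | [], _ => by simp
  | a :: l, h => by
    rw [List.map_cons, List.prod_cons, ExteriorAlgebra.ι, CliffordAlgebra.contractLeft_ι_mul,
      h a (by simp), zero_smul, zero_sub]
    have := contractLeft_list_prod_eq_zero d l fun w hw => h w (by simp [hw])
    rw [ExteriorAlgebra.ι] at this
    rw [this, mul_zero, neg_zero]

/-- On products of pairwise orthogonal vectors, `C(V,-V) ≅ Λ(V ⊕ V)` replaces Clifford by exterior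
products. -/
theorem equivExterior_prod_of_pairwise {n : ℕ} : ∀ l : List (VV n),
    l.Pairwise (fun v w => QuadraticMap.polar (-splitForm n) v w = 0) →
      CliffordAlgebra.equivExterior (-splitForm n)
        (l.map (CliffordAlgebra.ι (-splitForm n))).prod = (l.map (ExteriorAlgebra.ι ℝ)).prod
  | [], _ => CliffordAlgebra.changeForm_one CliffordAlgebra.changeForm.associated_neg_proof
  | a :: l, h => by
    rw [List.pairwise_cons] at h
    have ih := equivExterior_prod_of_pairwise l h.2
    have h1 : CliffordAlgebra.equivExterior (-splitForm n)
        (CliffordAlgebra.ι (-splitForm n) a *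
          (l.map (CliffordAlgebra.ι (-splitForm n))).prod) =
        ExteriorAlgebra.ι ℝ a * CliffordAlgebra.equivExterior (-splitForm n)
          (l.map (CliffordAlgebra.ι (-splitForm n))).prod - CliffordAlgebra.contractLeft
          ((QuadraticMap.associated (R := ℝ) (M := VV n) (-(-splitForm n))) a)
          (CliffordAlgebra.equivExterior (-splitForm n)
          (l.map (CliffordAlgebra.ι (-splitForm n))).prod) :=
      CliffordAlgebra.changeForm_ι_mul CliffordAlgebra.changeForm.associated_neg_proof _ _
    rw [List.map_cons, List.prod_cons, h1, ih, contractLeft_list_prod_eq_zero, sub_zero,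
      List.map_cons, List.prod_cons]
    intro w hw
    have h2 := h.1 w hw
    rw [map_neg, LinearMap.neg_apply, LinearMap.neg_apply, QuadraticMap.associated_apply,
      ← QuadraticMap.polar, h2, smul_zero, neg_zero]

/-! ### The product of the `ê_i e_i` as `(-1)^N` -/

theorem extMul_mul_intMul_anticomm {n : ℕ} {i j : Fin n} (h : i ≠ j) :
    intMul (Pi.single i (1 : ℝ)) * extMul (Pi.single j 1) =
      -(extMul (Pi.single j 1) * intMul (Pi.single i 1)) := by
  rw [intMul_mul_extMul]
  simp [h]

theorem extMul_mul_extMul_swap {n : ℕ} (v w : V n) :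
    extMul v * extMul w = -(extMul w * extMul v) := by
  have h := extMul_mul_self (v + w)
  rw [map_add, add_mul, mul_add, mul_add, extMul_mul_self, extMul_mul_self, zero_add,
    add_zero] at h
  exact eq_neg_of_add_eq_zero_left h

theorem cliffordGenerators_e {n : ℕ} (i : Fin n) :
    cliffordGenerators n (e i) = extMul (Pi.single i 1) - intMul (Pi.single i 1) := by
  simp [cliffordGenerators, e]

theorem cliffordGenerators_eHat {n : ℕ} (i : Fin n) :
    cliffordGenerators n (eHat i) = extMul (Pi.single i 1) + intMul (Pi.single i 1) := by
  simp [cliffordGenerators, eHat]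

theorem cliffordGenerators_eHat_mul_e {n : ℕ} (i : Fin n) :
    cliffordGenerators n (eHat i) * cliffordGenerators n (e i) =
      1 - (2 : ℝ) • (extMul (Pi.single i 1) * intMul (Pi.single i 1)) := by
  rw [cliffordGenerators_e, cliffordGenerators_eHat, add_mul, mul_sub, mul_sub, extMul_mul_self,
    intMul_mul_self, intMul_mul_extMul, two_smul]
  simp
  abel

/-- The relations make `a * b` idempotent, so `1 - 2ab` is the sign `±1` recording whether one mode
is occupied; multiplying by `a` changes the occupation. -/
theorem reflection_mul_self {R : Type*} [Ring R] [Algebra ℝ R] {a b : R} (ha : a * a = 0)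
    (hba : b * a = 1 - a * b) :
    (1 - (2 : ℝ) • (a * b)) * a = (-1 : ℝ) • (a * (1 - (2 : ℝ) • (a * b))) := by
  have h : a * (a * b) = 0 := by rw [← mul_assoc, ha, zero_mul]
  rw [sub_mul, mul_sub, smul_mul_assoc, mul_smul_comm, mul_assoc a b a, hba, mul_sub, h, two_smul]
  simp

theorem reflection_mul_of_anticomm {R : Type*} [Ring R] [Algebra ℝ R] {a b c : R}
    (hac : a * c = -(c * a)) (hbc : b * c = -(c * b)) :
    (1 - (2 : ℝ) • (a * b)) * c = c * (1 - (2 : ℝ) • (a * b)) := by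
  rw [sub_mul, mul_sub, smul_mul_assoc, mul_smul_comm, mul_assoc a b c, hbc, mul_neg, ← mul_assoc,
    hac, neg_mul, neg_neg, mul_assoc, one_mul, mul_one]

/-- Only the factor with index `j` changes sign when passing `ε(e_j)`; without repetitions it occurs
at most once. -/
theorem list_prod_reflection {n : ℕ} (j : Fin n) : ∀ l : List (Fin n), l.Nodup →
    (l.map fun i => cliffordGenerators n (eHat i) * cliffordGenerators n (e i)).prod *
        extMul (Pi.single j 1) = (if j ∈ l then (-1 : ℝ) else 1) • (extMul (Pi.single j 1) *
      (l.map fun i => cliffordGenerators n (eHat i) * cliffordGenerators n (e i)).prod)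
  | [], _ => by simp
  | i :: l, h => by
    rw [List.nodup_cons] at h
    have ih := list_prod_reflection j l h.2
    rw [List.map_cons, List.prod_cons, mul_assoc, ih, mul_smul_comm, ← mul_assoc, ← mul_assoc]
    by_cases hij : i = j
    · subst hij
      have h1 : cliffordGenerators n (eHat i) * cliffordGenerators n (e i) *
          extMul (Pi.single i 1) = (-1 : ℝ) • (extMul (Pi.single i 1) *
            (cliffordGenerators n (eHat i) * cliffordGenerators n (e i))) := by
        rw [cliffordGenerators_eHat_mul_e]
        refine reflection_mul_self (extMul_mul_self _) ?_
        rw [intMul_mul_extMul]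
        simp
      rw [h1, if_neg h.1, one_smul, if_pos (by simp), smul_mul_assoc]
    · have h1 : cliffordGenerators n (eHat i) * cliffordGenerators n (e i) *
          extMul (Pi.single j 1) = extMul (Pi.single j 1) *
            (cliffordGenerators n (eHat i) * cliffordGenerators n (e i)) := by
        rw [cliffordGenerators_eHat_mul_e]
        exact reflection_mul_of_anticomm (extMul_mul_extMul_swap _ _)
          (extMul_mul_intMul_anticomm hij)
      rw [h1]
      congr 1
      simp [Ne.symm hij]

/-- Each factor is `1 - 2 ε(e_i) ι(e_i)`. It fixes `1`, which interior multiplication kills, and for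
every `j` exactly one factor anticommutes with `ε(e_j)`. -/
theorem ofFn_prod_reflection (n : ℕ) :
    (List.ofFn fun i : Fin n => cliffordGenerators n (eHat i) * cliffordGenerators n (e i)).prod =
      parity n := by
  rw [List.ofFn_eq_map]
  refine parity_eq_of_extMul ?_ fun v => ?_
  · induction List.finRange n with
    | nil => simp
    | cons i l ih =>
      rw [List.map_cons, List.prod_cons, Module.End.mul_apply, ih, cliffordGenerators_eHat_mul_e]
      simp [intMul]
  · have hv : v = ∑ j, v j • Pi.single j (1 : ℝ) := by
      ext k
      simp [Finset.sum_apply, Pi.single_apply]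
    rw [hv, map_sum, Finset.mul_sum, Finset.sum_mul, ← Finset.sum_neg_distrib]
    refine Finset.sum_congr rfl fun j _ => ?_
    rw [map_smul, mul_smul_comm, list_prod_reflection j _ (List.nodup_finRange n),
      if_pos (List.mem_finRange j), smul_comm, smul_mul_assoc]
    exact (neg_one_smul ℝ (_ : EndExt n))

/-- Reordering into the product of the `ê_i e_i` gives the sign; the rest is `Tr((-1)^N (-1)^N) =
dim ΛV`. -/
theorem supertrace_top (n : ℕ) :
    supertrace n (cliffordAction n ((List.ofFn fun i : Fin n =>
        CliffordAlgebra.ι (-splitForm n) (e i)).prod *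
      (List.ofFn fun i : Fin n => CliffordAlgebra.ι (-splitForm n) (eHat i)).prod)) =
      (-1) ^ (n * (n + 1) / 2) * 2 ^ n := by
  rw [ofFn_prod_mul_ofFn_prod, map_smul, map_list_prod, List.map_ofFn]
  · have h : (cliffordAction n ∘ fun i : Fin n => CliffordAlgebra.ι (-splitForm n) (eHat i) *
        CliffordAlgebra.ι (-splitForm n) (e i)) =
        fun i => cliffordGenerators n (eHat i) * cliffordGenerators n (e i) := by
      funext i
      simp [cliffordAction_ι]
    rw [h, ofFn_prod_reflection, map_smul, supertrace_apply, parity_mul_parity, LinearMap.trace_one,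
      finrank_exteriorAlgebra, smul_eq_mul]
    norm_num
  · intro i j
    have := CliffordAlgebra.ι_mul_ι_add_swap (Q := -splitForm n) (eHat i) (e j)
    rw [← basisVV_castAdd, ← basisVV_natAdd, polar_basisVV, map_zero] at this
    · rw [← basisVV_castAdd, ← basisVV_natAdd]
      exact eq_neg_of_add_eq_zero_left this
    · intro h
      have := congrArg Fin.val h
      simp at this
      omega

/-- The supertrace of the Clifford action is `(4π)^{n/2}` times the Berezin trace of the symbol. -/
theorem supertrace_cliffordAction {n : ℕ} (x : Cl n) :
    supertrace n (cliffordAction n x) = (4 * Real.pi) ^ ((n : ℝ) / 2) *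
      berezin n (CliffordAlgebra.equivExterior (-splitForm n) x) := by
  have key : (supertrace n ∘ₗ (cliffordAction n).toLinearMap) ∘ₗ
      (CliffordAlgebra.equivExterior (-splitForm n)).symm.toLinearMap =
      ((4 * Real.pi) ^ ((n : ℝ) / 2)) • berezin n := by
    have hprod : ∀ {k : ℕ} (v : Fin k → Fin (n + n)), Function.Injective v →
        (CliffordAlgebra.equivExterior (-splitForm n)).symm
          (ExteriorAlgebra.ιMulti ℝ k fun i => basisVV n (v i)) =
        ((List.ofFn fun i => basisVV n (v i)).map (CliffordAlgebra.ι (-splitForm n))).prod := by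
      intro k v hv
      rw [LinearEquiv.symm_apply_eq, equivExterior_prod_of_pairwise, ExteriorAlgebra.ιMulti_apply,
        List.map_ofFn]
      · rfl
      · rw [List.pairwise_ofFn]
        exact fun i j hij => polar_basisVV (hv.ne hij.ne)
    -- Both functionals are compared as alternating forms in each degree: in degree `2n` one value
    -- decides, in the other degrees both vanish.
    refine ExteriorAlgebra.lhom_ext fun k => ?_
    rcases eq_or_ne k (n + n) with rfl | hk
    · rw [AlternatingMap.eq_smul_basis_det (basisVV n) (LinearMap.compAlternatingMap _ _),
        AlternatingMap.eq_smul_basis_det (basisVV n)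
          ((((4 * Real.pi) ^ ((n : ℝ) / 2)) • berezin n).compAlternatingMap _)]
      congr 1
      have h1 := hprod (id : Fin (n + n) → Fin (n + n)) Function.injective_id
      simp only [id_eq] at h1
      simp only [LinearMap.compAlternatingMap_apply, LinearMap.comp_apply,
        LinearEquiv.coe_coe, LinearMap.smul_apply, AlgHom.toLinearMap_apply]
      refine (congrArg (fun y => supertrace n (cliffordAction n y)) h1).trans ?_
      have h2 : (List.ofFn fun i => basisVV n i) =
          (List.ofFn fun i : Fin n => e i) ++ List.ofFn fun i : Fin n => eHat i := by
        rw [← List.ofFn_fin_append]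
        congr 1
        funext i
        refine Fin.addCases (fun j => ?_) (fun j => ?_) i
        · rw [Fin.append_left, basisVV_castAdd]
        · rw [Fin.append_right, basisVV_natAdd]
      rw [h2, List.map_append, List.prod_append, List.map_ofFn, List.map_ofFn]
      refine (supertrace_top n).trans ?_
      rw [berezin, LinearMap.smul_apply, ExteriorAlgebra.liftAlternating_apply_ιMulti,
        Pi.single_eq_same]
      have h3 : (basisVV n).det (fun i => basisVV n i) = 1 := Module.Basis.det_self _
      -- The constants match because `(4π)^{n/2} π^{-n/2} = 2^n`.
      rw [h3, smul_eq_mul, smul_eq_mul, mul_one, ← mul_assoc,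
        Real.mul_rpow (by norm_num) Real.pi_pos.le, mul_assoc ((4 : ℝ) ^ _),
        ← Real.rpow_add Real.pi_pos, show (4 : ℝ) = 2 ^ (2 : ℝ) by norm_num,
        ← Real.rpow_mul (by norm_num), neg_div, add_neg_cancel, Real.rpow_zero, mul_one,
        mul_div_cancel₀ _ (by norm_num : (2 : ℝ) ≠ 0), Real.rpow_natCast, mul_comm]
    · refine (basisVV n).ext_alternating fun v hv => ?_
      have hr : (((4 * Real.pi) ^ ((n : ℝ) / 2)) • berezin n).compAlternatingMap
          (ExteriorAlgebra.ιMulti ℝ k) (fun i => basisVV n (v i)) = 0 := by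
        rw [LinearMap.compAlternatingMap_apply, LinearMap.smul_apply, berezin_ιMulti_of_ne hk,
          smul_zero]
      rw [hr]
      refine (congrArg (fun y => supertrace n (cliffordAction n y)) (hprod v hv)).trans ?_
      -- For `k ≠ 2n`, distinct basis vectors miss some `basisVV n j`, which is anisotropic and
      -- orthogonal to all of them.
      have hs : ¬Function.Surjective v := fun hs => hk (by
        simpa using Fintype.card_of_bijective ⟨hv, hs⟩)
      rw [Function.Surjective] at hs
      push Not at hs
      obtain ⟨j, hj⟩ := hs
      refine supertrace_prod_eq_zero (splitForm_basisVV_ne_zero j) _ fun w hw => ?_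
      obtain ⟨i, rfl⟩ := (List.mem_ofFn' _ _).1 hw
      exact polar_basisVV (hj i).symm
  have := LinearMap.congr_fun key (CliffordAlgebra.equivExterior (-splitForm n) x)
  simp only [LinearMap.comp_apply, LinearEquiv.coe_coe, LinearEquiv.symm_apply_apply,
    AlgHom.toLinearMap_apply, LinearMap.smul_apply, smul_eq_mul] at this
  exact this

/-! ### Multiplicativity of symbols -/

theorem exteriorLT_mono {n j k : ℕ} (h : j ≤ k) : exteriorLT n j ≤ exteriorLT n k :=
  Submodule.span_mono fun _ ⟨l, hl, hx⟩ => ⟨l, hl.trans_le h, hx⟩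

/-- Degrees at most `j - 1` and `k - 1` add to at most `j + k - 2`, whence the shift by one in the
hypothesis. -/
theorem mul_mem_exteriorLT {n j k m : ℕ} (h : j + k ≤ m + 1) {x y : ExteriorAlgebra ℝ (VV n)}
    (hx : x ∈ exteriorLT n j) (hy : y ∈ exteriorLT n k) : x * y ∈ exteriorLT n m := by
  have := Submodule.mul_mem_mul hx hy
  rw [exteriorLT, exteriorLT, Submodule.span_mul_span] at this
  refine Submodule.span_mono ?_ this
  rintro _ ⟨_, ⟨l₁, h₁, rfl⟩, _, ⟨l₂, h₂, rfl⟩, rfl⟩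
  refine ⟨l₁ ++ l₂, ?_, by simp⟩
  rw [List.length_append]
  omega

theorem mul_mem_cliffordFiltration {n j k : ℕ} {x y : Cl n}
    (hx : x ∈ cliffordFiltration n j) (hy : y ∈ cliffordFiltration n k) :
    x * y ∈ cliffordFiltration n (j + k) := by
  have := Submodule.mul_mem_mul hx hy
  rw [cliffordFiltration, cliffordFiltration, Submodule.span_mul_span] at this
  refine Submodule.span_mono ?_ this
  rintro _ ⟨_, ⟨l₁, h₁, rfl⟩, _, ⟨l₂, h₂, rfl⟩, rfl⟩
  refine ⟨l₁ ++ l₂, ?_, by simp⟩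
  rw [List.length_append]
  omega

theorem list_prod_mem_exteriorLT {n k : ℕ} (l : List (VV n)) (h : l.length < k) :
    (l.map (ExteriorAlgebra.ι ℝ)).prod ∈ exteriorLT n k :=
  Submodule.subset_span ⟨l, h, rfl⟩

theorem equivExterior_mem_exteriorLT {n k : ℕ} {a : Cl n} (ha : a ∈ cliffordFiltration n k) :
    CliffordAlgebra.equivExterior (-splitForm n) a ∈ exteriorLT n (k + 1) := by
  induction ha using Submodule.span_induction with
  | mem x h =>
    obtain ⟨l, hl, rfl⟩ := h
    rw [← sub_add_cancel (CliffordAlgebra.equivExterior (-splitForm n) _)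
      (l.map (ExteriorAlgebra.ι ℝ)).prod]
    exact add_mem (exteriorLT_mono (by omega) (equivExterior_prod_sub_mem l))
      (list_prod_mem_exteriorLT l (by omega))
  | zero => rw [map_zero]; exact zero_mem _
  | add x y _ _ hx hy => rw [map_add]; exact add_mem hx hy
  | smul r x _ hx => rw [map_smul]; exact Submodule.smul_mem _ r hx

/-- On products of vectors, the Clifford product of the concatenated list and the product of the two
images both have leading term the concatenated wedge product. -/
theorem equivExterior_mul_sub_mem {n j k : ℕ} {a b : Cl n} (ha : a ∈ cliffordFiltration n j)
    (hb : b ∈ cliffordFiltration n k) :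
    CliffordAlgebra.equivExterior (-splitForm n) (a * b) -
      CliffordAlgebra.equivExterior (-splitForm n) a *
        CliffordAlgebra.equivExterior (-splitForm n) b ∈ exteriorLT n (j + k) := by
  induction ha, hb using Submodule.span_induction₂ with
  | mem_mem x y hx hy =>
    obtain ⟨l₁, h₁, rfl⟩ := hx
    obtain ⟨l₂, h₂, rfl⟩ := hy
    have h := equivExterior_prod_sub_mem (l₁ ++ l₂)
    have h1 := equivExterior_prod_sub_mem l₁
    have h2 := equivExterior_prod_sub_mem l₂
    rw [List.map_append, List.prod_append, List.map_append, List.prod_append,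
      List.length_append] at h
    set X := (l₁.map (CliffordAlgebra.ι (-splitForm n))).prod
    set Y := (l₂.map (CliffordAlgebra.ι (-splitForm n))).prod
    set u := (l₁.map (ExteriorAlgebra.ι ℝ : VV n →ₗ[ℝ] _)).prod
    set v := (l₂.map (ExteriorAlgebra.ι ℝ : VV n →ₗ[ℝ] _)).prod
    have hY : CliffordAlgebra.equivExterior (-splitForm n) Y ∈ exteriorLT n (l₂.length + 1) :=
      equivExterior_mem_exteriorLT (prod_mem_cliffordFiltration l₂ le_rfl)
    have hu : u ∈ exteriorLT n (l₁.length + 1) := list_prod_mem_exteriorLT l₁ (by omega)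
    have h3 := mul_mem_exteriorLT (m := l₁.length + l₂.length) (by omega) h1 hY
    have h4 := mul_mem_exteriorLT (m := l₁.length + l₂.length) (by omega) hu h2
    refine exteriorLT_mono (by omega : l₁.length + l₂.length ≤ j + k) ?_
    convert sub_mem (sub_mem h h3) h4 using 1
    noncomm_ring
  | zero_left y _ => simp
  | zero_right x _ => simp
  | add_left x y z _ _ _ h1 h2 =>
    convert add_mem h1 h2 using 1
    simp only [add_mul, map_add]
    abel
  | add_right x y z _ _ _ h1 h2 =>
    convert add_mem h1 h2 using 1
    simp only [mul_add, map_add]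
    abel
  | smul_left r x y _ _ h =>
    convert Submodule.smul_mem _ r h using 1
    simp only [smul_mul_assoc, map_smul, smul_sub]
  | smul_right r x y _ _ h =>
    convert Submodule.smul_mem _ r h using 1
    simp only [mul_smul_comm, map_smul, smul_sub]

/-- `u` represents the `k`-th symbol of `a ∈ C^k(V,-V)` modulo terms of lower degree. -/
structure IsSymbol (n k : ℕ) (a : Cl n) (u : ExteriorAlgebra ℝ (VV n)) : Prop where
  mem : a ∈ cliffordFiltration n k
  symbol_mem : u ∈ exteriorLT n (k + 1)
  sub_mem : CliffordAlgebra.equivExterior (-splitForm n) a - u ∈ exteriorLT n k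

namespace IsSymbol

variable {n j k : ℕ} {a b : Cl n} {u v : ExteriorAlgebra ℝ (VV n)}

/-- With `â`, `b̂` the exterior images, the error telescopes into the defect of multiplicativity,
`(â - u) b̂` and `u (b̂ - v)`, each of degree below `j + k`. -/
theorem mul (h : IsSymbol n j a u) (h' : IsSymbol n k b v) :
    IsSymbol n (j + k) (a * b) (u * v) where
  mem := mul_mem_cliffordFiltration h.mem h'.mem
  symbol_mem := mul_mem_exteriorLT (by omega) h.symbol_mem h'.symbol_mem
  sub_mem := by
    have h1 := mul_mem_exteriorLT (m := j + k) (by omega) h.sub_mem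
      (equivExterior_mem_exteriorLT h'.mem)
    have h2 := mul_mem_exteriorLT (m := j + k) (by omega) h.symbol_mem h'.sub_mem
    convert add_mem (add_mem (equivExterior_mul_sub_mem h.mem h'.mem) h1) h2 using 1
    noncomm_ring

theorem add (h : IsSymbol n k a u) (h' : IsSymbol n k b v) : IsSymbol n k (a + b) (u + v) where
  mem := add_mem h.mem h'.mem
  symbol_mem := add_mem h.symbol_mem h'.symbol_mem
  sub_mem := by
    convert add_mem h.sub_mem h'.sub_mem using 1
    rw [map_add]
    abel

theorem smul (r : ℝ) (h : IsSymbol n k a u) : IsSymbol n k (r • a) (r • u) where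
  mem := Submodule.smul_mem _ r h.mem
  symbol_mem := Submodule.smul_mem _ r h.symbol_mem
  sub_mem := by
    convert Submodule.smul_mem _ r h.sub_mem using 1
    rw [map_smul, smul_sub]

theorem zero : IsSymbol n k 0 0 := ⟨zero_mem _, zero_mem _, by simp⟩

theorem sum {ι : Type*} (s : Finset ι) {a : ι → Cl n} {u : ι → ExteriorAlgebra ℝ (VV n)}
    (h : ∀ i ∈ s, IsSymbol n k (a i) (u i)) : IsSymbol n k (∑ i ∈ s, a i) (∑ i ∈ s, u i) := by
  classical
  induction s using Finset.induction_on with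
  | empty => simpa using zero
  | insert i s hi ih =>
    rw [Finset.sum_insert hi, Finset.sum_insert hi]
    exact (h i (Finset.mem_insert_self i s)).add
      (ih fun j hj => h j (Finset.mem_insert_of_mem hj))

theorem list_prod (l : List (VV n)) : IsSymbol n l.length
    (l.map (CliffordAlgebra.ι (-splitForm n))).prod (l.map (ExteriorAlgebra.ι ℝ)).prod where
  mem := prod_mem_cliffordFiltration l le_rfl
  symbol_mem := list_prod_mem_exteriorLT l (by omega)
  sub_mem := equivExterior_prod_sub_mem l

theorem pow (h : IsSymbol n k a u) : ∀ m : ℕ, IsSymbol n (k * m) (a ^ m) (u ^ m)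
  | 0 => by simpa using list_prod (n := n) []
  | m + 1 => by
    rw [pow_succ, pow_succ, mul_add, mul_one]
    exact (h.pow m).mul h

end IsSymbol

/-! ### Homogeneous symbols and the degree of the Berezin trace -/

theorem proj_list_prod {n k : ℕ} (l : List (VV n)) :
    GradedAlgebra.proj (fun j : ℕ => ⋀[ℝ]^j (VV n)) k (l.map (ExteriorAlgebra.ι ℝ)).prod =
      if l.length = k then (l.map (ExteriorAlgebra.ι ℝ)).prod else 0 := by
  rw [GradedAlgebra.proj_apply]
  split_ifs with h
  · subst h
    exact DirectSum.decompose_of_mem_same (fun j : ℕ => ⋀[ℝ]^j (VV n)) (prod_mem_exteriorPower l)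
  · exact DirectSum.decompose_of_mem_ne (fun j : ℕ => ⋀[ℝ]^j (VV n)) (prod_mem_exteriorPower l) h

theorem proj_mem_and_sub_proj_mem {n k : ℕ} {x : ExteriorAlgebra ℝ (VV n)}
    (hx : x ∈ exteriorLT n (k + 1)) :
    GradedAlgebra.proj (fun j : ℕ => ⋀[ℝ]^j (VV n)) k x ∈ exteriorLT n (k + 1) ∧
      x - GradedAlgebra.proj (fun j : ℕ => ⋀[ℝ]^j (VV n)) k x ∈ exteriorLT n k := by
  induction hx using Submodule.span_induction with
  | mem x h =>
    obtain ⟨l, hl, rfl⟩ := h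
    rw [proj_list_prod]
    split_ifs with h
    · exact ⟨list_prod_mem_exteriorLT l hl, by simp⟩
    · exact ⟨zero_mem _, by rw [sub_zero]; exact list_prod_mem_exteriorLT l (by omega)⟩
  | zero => simp
  | add x y _ _ hx hy =>
    rw [map_add, add_sub_add_comm]
    exact ⟨add_mem hx.1 hy.1, add_mem hx.2 hy.2⟩
  | smul r x _ hx =>
    rw [map_smul, ← smul_sub]
    exact ⟨Submodule.smul_mem _ r hx.1, Submodule.smul_mem _ r hx.2⟩

theorem isSymbol_symbol {n k : ℕ} (b : cliffordFiltration n k) :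
    IsSymbol n k b (symbol n k b) :=
  have h := proj_mem_and_sub_proj_mem (equivExterior_mem_exteriorLT b.2)
  ⟨b.2, h.1, h.2⟩

theorem symbol_mem_exteriorPower {n k : ℕ} (b : cliffordFiltration n k) :
    symbol n k b ∈ ⋀[ℝ]^k (VV n) :=
  SetLike.coe_mem _

theorem berezin_eq_zero_of_mem {n k : ℕ} (hk : k ≠ n + n) {x : ExteriorAlgebra ℝ (VV n)}
    (hx : x ∈ ⋀[ℝ]^k (VV n)) : berezin n x = 0 := by
  rw [← ExteriorAlgebra.ιMulti_span_fixedDegree] at hx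
  induction hx using Submodule.span_induction with
  | mem x h =>
    obtain ⟨v, rfl⟩ := h
    exact berezin_ιMulti_of_ne hk v
  | zero => simp
  | add x y _ _ hx hy => rw [map_add, hx, hy, add_zero]
  | smul r x _ hx => rw [map_smul, hx, smul_zero]

theorem berezin_eq_zero_of_mem_exteriorLT {n : ℕ} {x : ExteriorAlgebra ℝ (VV n)}
    (hx : x ∈ exteriorLT n (n + n)) : berezin n x = 0 := by
  induction hx using Submodule.span_induction with
  | mem x h =>
    obtain ⟨l, hl, rfl⟩ := h
    exact berezin_eq_zero_of_mem hl.ne (prod_mem_exteriorPower l)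
  | zero => simp
  | add x y _ _ hx hy => rw [map_add, hx, hy, add_zero]
  | smul r x _ hx => rw [map_smul, hx, smul_zero]

/-- The Berezin trace ignores degrees below `2n`, hence also the lower-order difference between `a`
and its symbol. This covers both the vanishing for `k < 2n` and the leading value for `k = 2n`. -/
theorem supertrace_eq_of_isSymbol {n k : ℕ} {a : Cl n} {u : ExteriorAlgebra ℝ (VV n)}
    (h : IsSymbol n k a u) (hk : k ≤ n + n) :
    supertrace n (cliffordAction n a) = (4 * Real.pi) ^ ((n : ℝ) / 2) * berezin n u := by
  rw [supertrace_cliffordAction, ← sub_eq_zero, ← mul_sub, ← map_sub,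
    berezin_eq_zero_of_mem_exteriorLT (exteriorLT_mono hk h.sub_mem), mul_zero]

/-! ### The representation of `so(V)` through the Clifford algebra -/

/-- The element `½ (ê_i ê_j - e_i e_j)` of `C(V,-V)`, which acts on `ΛV` as `λ(E_ij)`. -/
def cliffordRotation {n : ℕ} (p : Pairs n) : Cl n :=
  (1 / 2 : ℝ) • (([eHat p.1.1, eHat p.1.2].map (CliffordAlgebra.ι (-splitForm n))).prod -
    ([e p.1.1, e p.1.2].map (CliffordAlgebra.ι (-splitForm n))).prod)

/-- The element `½ (ê_i ∧ ê_j - e_i ∧ e_j)` of `Λ(V ⊕ V)`. -/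
def exteriorRotation {n : ℕ} (p : Pairs n) : ExteriorAlgebra ℝ (VV n) :=
  (1 / 2 : ℝ) • (([eHat p.1.1, eHat p.1.2].map (ExteriorAlgebra.ι ℝ)).prod -
    ([e p.1.1, e p.1.2].map (ExteriorAlgebra.ι ℝ)).prod)

theorem isSymbol_rotation {n : ℕ} (p : Pairs n) :
    IsSymbol n 2 (cliffordRotation p) (exteriorRotation p) := by
  have h := ((IsSymbol.list_prod [eHat p.1.1, eHat p.1.2]).add
    ((IsSymbol.list_prod [e p.1.1, e p.1.2]).smul (-1))).smul (1 / 2)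
  rwa [neg_one_smul, neg_one_smul, ← sub_eq_add_neg, ← sub_eq_add_neg] at h

theorem exteriorRotation_mem {n : ℕ} (p : Pairs n) : exteriorRotation p ∈ ⋀[ℝ]^2 (VV n) :=
  Submodule.smul_mem _ _ (sub_mem (prod_mem_exteriorPower [eHat p.1.1, eHat p.1.2])
    (prod_mem_exteriorPower [e p.1.1, e p.1.2]))

/-- Used with `a, b = ε(e_k), ι(e_k)` and `c, d = ε(e_l), ι(e_l)`: the terms `εε` and `ιι` cancel,
the mixed ones double. -/
theorem half_smul_mul_sub_mul {R : Type*} [Ring R] [Algebra ℝ R] {a b c d : R}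
    (hbc : b * c + c * b = 0) :
    (1 / 2 : ℝ) • ((a + b) * (c + d) - (a - b) * (c - d)) = a * d - c * b := by
  have : (a + b) * (c + d) - (a - b) * (c - d) = (2 : ℝ) • (a * d - c * b) +
      (2 : ℝ) • (b * c + c * b) := by
    simp only [two_smul]
    noncomm_ring
  rw [this, hbc, smul_zero, add_zero, smul_smul]
  norm_num

theorem cliffordAction_cliffordRotation {n : ℕ} (p : Pairs n) :
    cliffordAction n (cliffordRotation p) =
      extMul (Pi.single p.1.1 1) * intMul (Pi.single p.1.2 1) -
        extMul (Pi.single p.1.2 1) * intMul (Pi.single p.1.1 1) := by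
  have h := extMul_mul_intMul_anticomm p.2.ne
  have h' : intMul (Pi.single p.1.1 1) * extMul (Pi.single p.1.2 1) +
      extMul (Pi.single p.1.2 1) * intMul (Pi.single p.1.1 (1 : ℝ)) = 0 :=
    eq_neg_iff_add_eq_zero.1 h
  rw [cliffordRotation, map_smul, map_sub, map_list_prod, map_list_prod]
  simp only [List.map_cons, List.map_nil, List.prod_cons, List.prod_nil, mul_one,
    cliffordAction_ι, cliffordGenerators_e, cliffordGenerators_eHat]
  exact half_smul_mul_sub_mul h'

theorem soAction_soEquiv {n : ℕ} (x : EuclideanSpace ℝ (Pairs n)) :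
    soAction (soEquiv n x) = cliffordAction n (∑ p, x p • cliffordRotation p) := by
  have hcol : ∀ j, (soEquiv n x).1.mulVec (Pi.single j 1) =
      ∑ i, skewMatrix x.ofLp i j • Pi.single i (1 : ℝ) := by
    intro j
    ext k
    simp [Finset.sum_apply, Pi.single_apply]
    rfl
  rw [map_sum, soAction]
  simp only [map_smul, cliffordAction_cliffordRotation, hcol, map_sum, Finset.sum_mul,
    smul_mul_assoc]
  set f : Fin n × Fin n → EndExt n := fun q =>
    skewMatrix x.ofLp q.1 q.2 • (extMul (Pi.single q.1 1) * intMul (Pi.single q.2 1)) with hf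
  have h1 : ∑ j, ∑ i, skewMatrix x.ofLp i j • (extMul (Pi.single i 1) * intMul (Pi.single j 1)) =
      ∑ q, f q := by
    rw [Finset.sum_comm, Fintype.sum_prod_type]
  -- The sum over all matrix entries is folded onto `i < j`: the diagonal vanishes, and `(j,i)` is
  -- paired with `(i,j)`.
  have h2 : ∑ q, f q = ∑ q : Fin n × Fin n with q.1 < q.2, (f q + f q.swap) := by
    have ha : ∑ q : Fin n × Fin n with q.1 < q.2, f q.swap = ∑ q : Fin n × Fin n with q.2 < q.1, f q :=
      Finset.sum_bij' (fun q _ => q.swap) (fun q _ => q.swap) (by simp) (by simp) (by simp)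
        (by simp) (by simp)
    have hb : ∑ q : Fin n × Fin n with q.2 = q.1, f q = 0 := by
      refine Finset.sum_eq_zero fun q hq => ?_
      rw [Finset.mem_filter] at hq
      rw [hf]
      simp only [hq.2, skewMatrix_self, zero_smul]
    rw [Finset.sum_add_distrib, ha, ← Finset.sum_filter_add_sum_filter_not _ (fun q => q.1 < q.2)]
    congr 1
    rw [← add_zero (∑ q : Fin n × Fin n with q.2 < q.1, f q), ← hb, ← Finset.sum_union]
    · refine Finset.sum_congr (Finset.ext fun q => ?_) fun _ _ => rfl
      simp [le_iff_lt_or_eq]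
    · rw [Finset.disjoint_filter]
      exact fun q _ h h' => h.ne h'
  rw [h1, h2, Finset.sum_subtype (p := fun q : Fin n × Fin n => q.1 < q.2) _ (by simp)]
  refine Finset.sum_congr rfl fun p _ => ?_
  simp only [hf, Prod.fst_swap, Prod.snd_swap, skewMatrix_lt _ p.2, skewMatrix_gt _ p.2]
  rw [smul_sub, sub_eq_add_neg]
  congr 1
  exact neg_smul (x p) (_ : EndExt n)

/-- The element of `Λ²(V ⊕ V)` that is the symbol of `λ(A)`, `A` with coordinates `x`. -/
def rotationSymbol {n : ℕ} (x : Pairs n → ℝ) : ExteriorAlgebra ℝ (VV n) :=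
  ∑ p, x p • exteriorRotation p

/-- `λ(A)^m` has Clifford order `2m`. Above total order `2n` lower-order terms could contribute as
well, hence the bound. -/
theorem supertrace_mul_soAction_pow {n k m : ℕ} (b : cliffordFiltration n k)
    (x : EuclideanSpace ℝ (Pairs n)) (h : k + 2 * m ≤ n + n) :
    supertrace n (cliffordAction n b * soAction (soEquiv n x) ^ m) =
      (4 * Real.pi) ^ ((n : ℝ) / 2) * berezin n (symbol n k b * rotationSymbol x.ofLp ^ m) := by
  rw [soAction_soEquiv, ← map_pow, ← map_mul]
  exact supertrace_eq_of_isSymbol ((isSymbol_symbol b).mul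
    ((IsSymbol.sum _ fun p _ => (isSymbol_rotation p).smul (x p)).pow m)) h

theorem berezin_symbol_mul_pow_eq_zero {n k m : ℕ} (b : cliffordFiltration n k)
    (x : Pairs n → ℝ) (h : k + 2 * m ≠ n + n) :
    berezin n (symbol n k b * rotationSymbol x ^ m) = 0 := by
  have h1 : rotationSymbol x ∈ ⋀[ℝ]^2 (VV n) :=
    sum_mem fun p _ => Submodule.smul_mem _ _ (exteriorRotation_mem p)
  have h2 := SetLike.pow_mem_graded (A := fun j : ℕ => ⋀[ℝ]^j (VV n)) m h1
  have h3 := SetLike.mul_mem_graded (A := fun j : ℕ => ⋀[ℝ]^j (VV n))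
    (symbol_mem_exteriorPower b) h2
  exact berezin_eq_zero_of_mem (by simpa [mul_comm] using h) h3

/-! ### Exponentials of nilpotent elements -/

section Nilpotent

variable {R : Type*} [Ring R] [Algebra ℝ R]

/-- Only finitely many terms are nonzero, so the topology plays no role. -/
theorem algExp_eq_sum {a : R} {k : ℕ} (h : a ^ k = 0) :
    algExp a = ∑ m ∈ Finset.range k, ((m.factorial : ℝ)⁻¹) • a ^ m := by
  let _ := moduleTopology ℝ R
  refine tsum_eq_sum fun m hm => ?_
  rw [pow_eq_zero_of_le (by simpa using hm) h, smul_zero]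

theorem algExp_zero : algExp (0 : R) = 1 := by
  rw [algExp_eq_sum (k := 1) (by simp)]
  simp

theorem algExp_add {a b : R} (hab : Commute a b) (ha : IsNilpotent a) (hb : IsNilpotent b) :
    algExp (a + b) = algExp a * algExp b := by
  -- `IsNilpotent.exp` has rational coefficients; this structure is restricted from the real one so
  -- that the scalars agree.
  let _ : Module ℚ R := Module.compHom R (algebraMap ℚ ℝ)
  have key : ∀ c : R, IsNilpotent c → algExp c = IsNilpotent.exp c := by
    rintro c ⟨k, hk⟩
    rw [algExp_eq_sum hk, IsNilpotent.exp_eq_sum hk]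
    refine Finset.sum_congr rfl fun m _ => ?_
    change _ = (algebraMap ℚ ℝ (m.factorial : ℚ)⁻¹) • c ^ m
    simp
  rw [key _ (hab.isNilpotent_add ha hb), key _ ha, key _ hb,
    IsNilpotent.exp_add_of_commute hab ha hb]

theorem map_algExp {R' : Type*} [Ring R'] [Algebra ℝ R'] (f : R →ₐ[ℝ] R') {a : R}
    (ha : IsNilpotent a) : f (algExp a) = algExp (f a) := by
  obtain ⟨k, hk⟩ := ha
  rw [algExp_eq_sum hk, algExp_eq_sum (k := k) (by rw [← map_pow, hk, map_zero]), map_sum]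
  simp

end Nilpotent

theorem algExp_sum {R ι : Type*} [CommRing R] [Algebra ℝ R] (s : Finset ι) (a : ι → R)
    (h : ∀ i ∈ s, IsNilpotent (a i)) : algExp (∑ i ∈ s, a i) = ∏ i ∈ s, algExp (a i) := by
  classical
  induction s using Finset.induction_on with
  | empty => simpa using algExp_zero
  | insert i s hi ih =>
    rw [Finset.sum_insert hi, Finset.prod_insert hi, algExp_add (Commute.all _ _),
      ih fun j hj => h j (Finset.mem_insert_of_mem hj)]
    · exact h i (Finset.mem_insert_self i s)
    · exact isNilpotent_sum fun j hj => h j (Finset.mem_insert_of_mem hj)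

/-! ### Gaussian integrals -/

section Gaussian

open MeasureTheory Real

/-- The coefficients of `exp(-ta)` for `a³ = 0`. -/
def expCoeff (m : Fin 3) (t : ℝ) : ℝ := ![1, -t, t ^ 2 / 2] m

theorem integrable_expCoeff (m : Fin 3) :
    Integrable fun t : ℝ => exp (-(1 / 4) * t ^ 2) * expCoeff m t := by
  fin_cases m
  · simpa [expCoeff] using integrable_exp_neg_mul_sq (by norm_num : (0 : ℝ) < 1 / 4)
  · have := (integrable_mul_exp_neg_mul_sq (by norm_num : (0 : ℝ) < 1 / 4)).neg
    refine this.congr (.of_forall fun t => ?_)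
    simp [expCoeff, mul_comm]
  · have := (integrable_rpow_mul_exp_neg_mul_sq (by norm_num : (0 : ℝ) < 1 / 4)
      (by norm_num : (-1 : ℝ) < 2)).const_mul (1 / 2)
    refine this.congr (.of_forall fun t => ?_)
    simp [expCoeff]
    ring

theorem hasDerivAt_exp_neg_sq (t : ℝ) :
    HasDerivAt (fun t : ℝ => exp (-(1 / 4) * t ^ 2)) (exp (-(1 / 4) * t ^ 2) * (-(1 / 2) * t)) t := by
  have := (((hasDerivAt_pow 2 t).const_mul (-(1 / 4) : ℝ))).exp
  convert this using 2
  norm_num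
  ring

/-- The first moment is zero, and the variance `2` of the weight `e^{-t²/4}` cancels the `1/2` in
`t²/2`; hence `1, 0, 1`. -/
theorem integral_expCoeff (m : Fin 3) :
    ∫ t : ℝ, exp (-(1 / 4) * t ^ 2) * expCoeff m t = √(4 * π) * ![1, 0, 1] m := by
  have h0 : ∫ t : ℝ, exp (-(1 / 4) * t ^ 2) * expCoeff 0 t = √(4 * π) := by
    simp only [expCoeff, Matrix.cons_val_zero, mul_one]
    rw [integral_gaussian]
    congr 1
    ring
  fin_cases m
  · simpa using h0
  · have h1 := integral_eq_zero_of_hasDerivAt_of_integrable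
      (fun t => (hasDerivAt_exp_neg_sq t).const_mul 2)
      ((integrable_expCoeff 1).congr (.of_forall fun t => by simp [expCoeff]; ring))
      ((integrable_exp_neg_mul_sq (by norm_num : (0 : ℝ) < 1 / 4)).const_mul 2)
    simp only [Fin.mk_one, Matrix.cons_val_one, Matrix.cons_val_zero, mul_zero]
    rw [← h1]
    congr 1
    funext t
    simp [expCoeff]
    ring
  -- Integration by parts: `(-t e^{-t²/4})' = e^{-t²/4}(t²/2 - 1)`.
  · have h1 := integral_eq_zero_of_hasDerivAt_of_integrable
      (f := fun t : ℝ => -t * exp (-(1 / 4) * t ^ 2))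
      (f' := fun t : ℝ => exp (-(1 / 4) * t ^ 2) * expCoeff 2 t -
        exp (-(1 / 4) * t ^ 2) * expCoeff 0 t)
      (fun t => by
        refine ((hasDerivAt_neg t).mul (hasDerivAt_exp_neg_sq t)).congr_deriv ?_
        simp [expCoeff]
        ring)
      ((integrable_expCoeff 2).sub (integrable_expCoeff 0))
      ((integrable_expCoeff 1).congr (.of_forall fun t => by simp [expCoeff, mul_comm]))
    rw [integral_sub (integrable_expCoeff 2) (integrable_expCoeff 0), sub_eq_zero, h0] at h1
    simpa using h1

theorem integral_gaussian_prod {ι : Type*} [Fintype ι] (f : ι → Fin 3) :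
    ∫ y : EuclideanSpace ℝ ι, exp (-‖y‖ ^ 2 / 4) * ∏ p, expCoeff (f p) (y p) =
      ∏ p, (√(4 * π) * ![1, 0, 1] (f p)) := by
  rw [← (PiLp.volume_preserving_toLp ι).integral_comp
    (MeasurableEquiv.toLp 2 _).measurableEmbedding]
  rw [Finset.prod_congr rfl fun p _ => (integral_expCoeff (f p)).symm]
  rw [← integral_fintype_prod_volume_eq_prod]
  refine integral_congr_ae (.of_forall fun y => ?_)
  simp only [EuclideanSpace.norm_sq_eq, Finset.prod_mul_distrib, ← exp_sum, norm_eq_abs, sq_abs,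
    ← Finset.mul_sum]
  congr 2
  ring

theorem integrable_gaussian_prod {ι : Type*} [Fintype ι] (f : ι → Fin 3) :
    Integrable fun y : EuclideanSpace ℝ ι =>
      exp (-‖y‖ ^ 2 / 4) * ∏ p, expCoeff (f p) (y p) := by
  rw [← (PiLp.volume_preserving_toLp ι).integrable_comp_emb
    (MeasurableEquiv.toLp 2 _).measurableEmbedding]
  refine (Integrable.fintype_prod (μ := fun _ : ι => (volume : Measure ℝ)) fun p =>
    integrable_expCoeff (f p)).congr (.of_forall fun y => ?_)
  simp only [EuclideanSpace.norm_sq_eq, Finset.prod_mul_distrib, ← exp_sum, norm_eq_abs, sq_abs,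
    ← Finset.mul_sum, Function.comp_apply]
  congr 2
  ring

theorem algExp_neg_smul_of_cube {R : Type*} [Ring R] [Algebra ℝ R] {a : R} (h : a ^ 3 = 0)
    (t : ℝ) : algExp (-(t • a)) = ∑ m : Fin 3, expCoeff m t • a ^ (m : ℕ) := by
  rw [algExp_eq_sum (k := 3) (by rw [neg_pow, smul_pow, h, smul_zero, mul_zero]),
    Finset.sum_range]
  simp [Fin.sum_univ_three, expCoeff, smul_pow, smul_smul]
  ring_nf

/-- The Gaussian integral of `exp(-∑ y_p a_p)` for commuting elements `a_p` with `a_p³ = 0`. -/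
theorem integral_gaussian_algExp {R ι : Type*} [CommRing R] [Algebra ℝ R] [Fintype ι]
    (a : ι → R) (ha : ∀ p, a p ^ 3 = 0) (θ : R →ₗ[ℝ] ℝ) :
    ∫ y : EuclideanSpace ℝ ι, exp (-‖y‖ ^ 2 / 4) * θ (algExp (-∑ p, y p • a p)) =
      √(4 * π) ^ Fintype.card ι * θ (algExp (∑ p, a p ^ 2)) := by
  classical
  have h1 : ∀ y : EuclideanSpace ℝ ι, algExp (-∑ p, y p • a p) =
      ∑ f : ι → Fin 3, (∏ p, expCoeff (f p) (y p)) • ∏ p, a p ^ (f p : ℕ) := by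
    intro y
    rw [← Finset.sum_neg_distrib, algExp_sum]
    · simp only [algExp_neg_smul_of_cube (ha _), Finset.prod_univ_sum, Fintype.piFinset_univ]
      refine Finset.sum_congr rfl fun f _ => ?_
      simp only [Algebra.smul_def, Finset.prod_mul_distrib, map_prod]
    · exact fun p _ => ⟨3, by rw [neg_pow, smul_pow, ha, smul_zero, mul_zero]⟩
  -- Here `exp(a²) = 1 + a²`, whose coefficients on `1, a, a²` are the normalized moments `1, 0, 1`;
  -- the two expansions then agree term by term after integration.
  have h2 : algExp (∑ p, a p ^ 2) =
      ∑ f : ι → Fin 3, (∏ p, (![1, 0, 1] (f p) : ℝ)) • ∏ p, a p ^ (f p : ℕ) := by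
    have h4 : ∀ p, (a p ^ 2) ^ 2 = 0 := fun p => by
      rw [← pow_mul]; exact pow_eq_zero_of_le (by norm_num) (ha p)
    rw [algExp_sum]
    · have h3 : ∀ p, algExp (a p ^ 2) =
          ∑ m : Fin 3, (![1, 0, 1] m : ℝ) • a p ^ (m : ℕ) := fun p => by
        rw [algExp_eq_sum (h4 p)]
        simp [Fin.sum_univ_three, Finset.sum_range_succ]
      simp only [h3, Finset.prod_univ_sum, Fintype.piFinset_univ]
      refine Finset.sum_congr rfl fun f _ => ?_
      simp only [Algebra.smul_def, Finset.prod_mul_distrib, map_prod]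
    · exact fun p _ => ⟨2, h4 p⟩
  simp only [h1, h2, map_sum, map_smul, smul_eq_mul, Finset.mul_sum, ← mul_assoc]
  rw [integral_finsetSum _ fun f _ => (integrable_gaussian_prod f).mul_const _]
  refine Finset.sum_congr rfl fun f _ => ?_
  rw [integral_mul_const, integral_gaussian_prod, Finset.prod_mul_distrib, Finset.prod_const,
    Finset.card_univ]

end Gaussian

/-! ### The exponential of the rotation symbol -/

/-- A product of two vectors is even: moving a vector past it gives two signs. The rotation symbols
therefore lie in a commutative ring, where exponentials of sums factor. -/
theorem ι_mul_ι_mem_center {M : Type*} [AddCommGroup M] [Module ℝ M] (v w : M) :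
    ExteriorAlgebra.ι ℝ v * ExteriorAlgebra.ι ℝ w ∈
      Subalgebra.center ℝ (ExteriorAlgebra ℝ M) := by
  rw [Subalgebra.mem_center_iff]
  intro x
  induction x using ExteriorAlgebra.induction with
  | algebraMap r => exact Algebra.commutes _ _
  | ι u =>
    have h : ∀ a b : M, ExteriorAlgebra.ι ℝ a * ExteriorAlgebra.ι ℝ b =
        -(ExteriorAlgebra.ι ℝ b * ExteriorAlgebra.ι ℝ a) := fun a b =>
      eq_neg_of_add_eq_zero_left (ExteriorAlgebra.ι_add_mul_swap a b)
    rw [← mul_assoc, h u v, neg_mul, mul_assoc, h u w, mul_neg, neg_neg, mul_assoc]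
  | mul a b ha hb => rw [mul_assoc, hb, ← mul_assoc, ha, mul_assoc]
  | add a b ha hb => rw [add_mul, mul_add, ha, hb]

theorem exteriorRotation_mem_center {n : ℕ} (p : Pairs n) :
    exteriorRotation p ∈ Subalgebra.center ℝ (ExteriorAlgebra ℝ (VV n)) := by
  simp only [exteriorRotation, List.map_cons, List.map_nil, List.prod_cons, List.prod_nil, mul_one]
  exact Subalgebra.smul_mem _ (sub_mem (ι_mul_ι_mem_center _ _) (ι_mul_ι_mem_center _ _)) _

theorem ι_mul_ι_mul_self {M : Type*} [AddCommGroup M] [Module ℝ M] (v w : M) :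
    (ExteriorAlgebra.ι ℝ v * ExteriorAlgebra.ι ℝ w) *
      (ExteriorAlgebra.ι ℝ v * ExteriorAlgebra.ι ℝ w) = 0 := by
  have h := Subalgebra.mem_center_iff.1 (ι_mul_ι_mem_center v w) (ExteriorAlgebra.ι ℝ v)
  rw [← mul_assoc, ← h, ← mul_assoc, ExteriorAlgebra.ι_sq_zero, zero_mul, zero_mul]

/-- With `α = ê_k ∧ ê_l` and `β = e_k ∧ e_l` central of square zero, `¼(α - β)² = -½ αβ`. -/
theorem exteriorRotation_sq {n : ℕ} (p : Pairs n) :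
    exteriorRotation p ^ 2 = -(1 / 2 : ℝ) • (ExteriorAlgebra.ι ℝ (e p.1.1) *
      ExteriorAlgebra.ι ℝ (e p.1.2) * ExteriorAlgebra.ι ℝ (eHat p.1.1) *
        ExteriorAlgebra.ι ℝ (eHat p.1.2)) := by
  simp only [exteriorRotation, List.map_cons, List.map_nil, List.prod_cons, List.prod_nil, mul_one]
  rw [smul_pow, sq (_ - _), sub_mul, mul_sub, mul_sub, ι_mul_ι_mul_self, ι_mul_ι_mul_self,
    Subalgebra.mem_center_iff.1 (ι_mul_ι_mem_center (e p.1.1) (e p.1.2)), zero_sub, sub_zero,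
    ← neg_add', ← two_smul ℝ, ← smul_neg, smul_smul, smul_neg, neg_smul, mul_assoc _ _
      (ExteriorAlgebra.ι ℝ (eHat p.1.2))]
  norm_num

/-- A further factor `α - β` repeats `α` or `β` in `αβ`. -/
theorem exteriorRotation_cube {n : ℕ} (p : Pairs n) : exteriorRotation p ^ 3 = 0 := by
  rw [pow_succ, exteriorRotation_sq, mul_assoc _ _ (ExteriorAlgebra.ι ℝ (eHat p.1.2))]
  simp only [exteriorRotation, List.map_cons, List.map_nil, List.prod_cons, List.prod_nil, mul_one]
  rw [smul_mul_assoc, mul_smul_comm, mul_sub, mul_assoc, ι_mul_ι_mul_self, mul_zero, zero_sub,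
    Subalgebra.mem_center_iff.1 (ι_mul_ι_mem_center (e p.1.1) (e p.1.2)), ← mul_assoc,
    ι_mul_ι_mul_self, zero_mul, neg_zero, smul_zero, smul_zero]

/-- `exteriorRotation` as an element of the centre of `Λ(V ⊕ V)`. -/
def centralRotation {n : ℕ} (p : Pairs n) : Subalgebra.center ℝ (ExteriorAlgebra ℝ (VV n)) :=
  ⟨exteriorRotation p, exteriorRotation_mem_center p⟩

theorem centralRotation_cube {n : ℕ} (p : Pairs n) : centralRotation p ^ 3 = 0 :=
  Subtype.ext (exteriorRotation_cube p)

theorem isNilpotent_sum_centralRotation {n : ℕ} (y : Pairs n → ℝ) :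
    IsNilpotent (∑ p, y p • centralRotation p) :=
  isNilpotent_sum fun p _ => ⟨3, by rw [smul_pow, centralRotation_cube, smul_zero]⟩

theorem val_sum_centralRotation {n : ℕ} (y : Pairs n → ℝ) :
    (Subalgebra.center ℝ (ExteriorAlgebra ℝ (VV n))).val (∑ p, y p • centralRotation p) =
      rotationSymbol y := by
  rw [map_sum, rotationSymbol]
  rfl

theorem isNilpotent_rotationSymbol {n : ℕ} (y : Pairs n → ℝ) : IsNilpotent (rotationSymbol y) := by
  rw [← val_sum_centralRotation]
  exact (isNilpotent_sum_centralRotation y).map _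

theorem val_algExp_sum_sq (n : ℕ) :
    (Subalgebra.center ℝ (ExteriorAlgebra ℝ (VV n))).val
      (algExp (∑ p, centralRotation p ^ 2)) = algExp (-(1 / 2 : ℝ) • quarticElement n) := by
  rw [map_algExp]
  · congr 1
    rw [map_sum, quarticElement, Finset.smul_sum]
    exact Finset.sum_congr rfl fun p _ => exteriorRotation_sq p
  · exact isNilpotent_sum fun p _ => ⟨3, by
      rw [← pow_mul, mul_comm, pow_mul, centralRotation_cube, zero_pow two_ne_zero]⟩

theorem integral_gaussian_rotationSymbol {n : ℕ} (θ : ExteriorAlgebra ℝ (VV n) →ₗ[ℝ] ℝ) :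
    ∫ y : EuclideanSpace ℝ (Pairs n), Real.exp (-‖y‖ ^ 2 / 4) *
        θ (algExp (-rotationSymbol y.ofLp)) =
      √(4 * Real.pi) ^ Fintype.card (Pairs n) *
        θ (algExp (-(1 / 2 : ℝ) • quarticElement n)) := by
  have h := integral_gaussian_algExp (centralRotation (n := n)) centralRotation_cube
    (θ ∘ₗ (Subalgebra.center ℝ (ExteriorAlgebra ℝ (VV n))).val.toLinearMap)
  simp only [LinearMap.comp_apply, AlgHom.toLinearMap_apply] at h
  have h1 : ∀ y : EuclideanSpace ℝ (Pairs n),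
      (Subalgebra.center ℝ (ExteriorAlgebra ℝ (VV n))).val
        (algExp (-∑ p, y p • centralRotation p)) = algExp (-rotationSymbol y.ofLp) := fun y => by
    rw [map_algExp _ (isNilpotent_sum_centralRotation _).neg, map_neg, val_sum_centralRotation]
  refine (MeasureTheory.integral_congr_ae (.of_forall fun y => ?_)).trans (h.trans ?_)
  · exact congrArg (fun z => Real.exp (-‖y‖ ^ 2 / 4) * θ z) (h1 y).symm
  · exact congrArg (fun z => √(4 * Real.pi) ^ Fintype.card (Pairs n) * θ z) (val_algExp_sum_sq n)

/-! ### Exponentials of endomorphisms -/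

theorem exists_norm_le_of_finiteDimensional {E G : Type*} [NormedAddCommGroup E] [NormedSpace ℝ E]
    [FiniteDimensional ℝ E] [NormedAddCommGroup G] [NormedSpace ℝ G] (g : E →ₗ[ℝ] G) :
    ∃ C : ℝ, 0 ≤ C ∧ ∀ x, ‖g x‖ ≤ C * ‖x‖ :=
  ⟨‖LinearMap.toContinuousLinearMap g‖, norm_nonneg _,
    (LinearMap.toContinuousLinearMap g).le_opNorm⟩

section EndExp

open scoped Matrix.Norms.Operator

variable {X : Type*} [AddCommGroup X] [Module ℝ X] [FiniteDimensional ℝ X]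

/-- Endomorphisms as matrices with respect to a basis. -/
def endEquivMatrix (X : Type*) [AddCommGroup X] [Module ℝ X] [FiniteDimensional ℝ X] :
    Module.End ℝ X ≃ₐ[ℝ]
      Matrix (Fin (Module.finrank ℝ X)) (Fin (Module.finrank ℝ X)) ℝ :=
  LinearMap.toMatrixAlgEquiv (Module.finBasis ℝ X)

/-- On a finite-dimensional space the module topology is the norm topology of matrices, so the
series may be summed there. -/
theorem algExp_end (a : Module.End ℝ X) :
    algExp a = (endEquivMatrix X).symm (NormedSpace.exp (endEquivMatrix X a)) := by
  let _ := moduleTopology ℝ (Module.End ℝ X)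
  have _ : IsModuleTopology ℝ (Module.End ℝ X) := ⟨rfl⟩
  have _ : ContinuousAdd (Module.End ℝ X) := IsModuleTopology.toContinuousAdd ℝ _
  have _ : IsModuleTopology ℝ
      (Matrix (Fin (Module.finrank ℝ X)) (Fin (Module.finrank ℝ X)) ℝ) :=
    isModuleTopologyOfFiniteDimensional
  have h1 : Continuous (endEquivMatrix X) :=
    IsModuleTopology.continuous_of_linearMap (R := ℝ) (endEquivMatrix X).toLinearMap
  have h2 : Continuous (endEquivMatrix X).symm :=
    IsModuleTopology.continuous_of_linearMap (R := ℝ) (endEquivMatrix X).symm.toLinearMap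
  have _ : T2Space (Module.End ℝ X) := .of_injective_continuous (endEquivMatrix X).injective h1
  have h3 := (NormedSpace.exp_series_hasSum_exp' (𝕂 := ℝ) (endEquivMatrix X a)).map
    (endEquivMatrix X).symm h2
  refine Eq.trans (tsum_congr fun k => ?_) h3.tsum_eq
  simp

theorem hasSum_algExp_end (θ : Module.End ℝ X →ₗ[ℝ] ℝ) (a : Module.End ℝ X) :
    HasSum (fun k : ℕ => ((k.factorial : ℝ)⁻¹) * θ (a ^ k)) (θ (algExp a)) := by
  have h2 : Continuous (θ ∘ₗ (endEquivMatrix X).symm.toLinearMap) :=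
    LinearMap.continuous_of_finiteDimensional _
  have h3 := (NormedSpace.exp_series_hasSum_exp' (𝕂 := ℝ) (endEquivMatrix X a)).map _ h2
  rw [algExp_end]
  refine HasSum.congr_fun h3 fun k => ?_
  simp

theorem continuous_algExp_end {E : Type*} [NormedAddCommGroup E] [NormedSpace ℝ E]
    [FiniteDimensional ℝ E] (θ : Module.End ℝ X →ₗ[ℝ] ℝ) (f : E →ₗ[ℝ] Module.End ℝ X) :
    Continuous fun y => θ (algExp (f y)) := by
  have h1 : Continuous ((endEquivMatrix X).toLinearMap ∘ₗ f) :=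
    LinearMap.continuous_of_finiteDimensional _
  have h2 : Continuous (θ ∘ₗ (endEquivMatrix X).symm.toLinearMap) :=
    LinearMap.continuous_of_finiteDimensional _
  have h3 := h2.comp (NormedSpace.exp_continuous.comp h1)
  simp only [algExp_end]
  exact h3

theorem exists_abs_pow_le {E : Type*} [NormedAddCommGroup E] [NormedSpace ℝ E]
    [FiniteDimensional ℝ E] (θ : Module.End ℝ X →ₗ[ℝ] ℝ) (f : E →ₗ[ℝ] Module.End ℝ X) :
    ∃ C M : ℝ, 0 ≤ C ∧ 0 ≤ M ∧ ∀ y k, |θ (f y ^ k)| ≤ C * (M * ‖y‖) ^ k := by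
  obtain ⟨C, hC, hT⟩ := exists_norm_le_of_finiteDimensional
    (θ ∘ₗ (endEquivMatrix X).symm.toLinearMap)
  obtain ⟨M, hM, hF⟩ := exists_norm_le_of_finiteDimensional ((endEquivMatrix X).toLinearMap ∘ₗ f)
  -- The summand `|θ 1|` serves `k = 0`, where submultiplicativity of the norm gives no bound.
  refine ⟨C + |θ 1|, M, by positivity, hM, fun y k => ?_⟩
  rcases k.eq_zero_or_pos with rfl | hk
  · simpa using hC
  · have h1 : θ (f y ^ k) = (θ ∘ₗ (endEquivMatrix X).symm.toLinearMap)
        (((endEquivMatrix X).toLinearMap ∘ₗ f) y ^ k) := by simp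
    rw [h1, ← Real.norm_eq_abs]
    calc _ ≤ C * ‖((endEquivMatrix X).toLinearMap ∘ₗ f) y ^ k‖ := hT _
      _ ≤ C * (M * ‖y‖) ^ k := by
        gcongr
        exact (norm_pow_le' _ hk).trans (by gcongr; exact hF _)
      _ ≤ _ := by
        gcongr
        simp

end EndExp

/-! ### Rescaled power series -/

/-- The truncated exponent `j + k - n` is harmless: where it truncates, the coefficient `u`
vanishes. -/
theorem rescaled_term {n j k : ℕ} {s u : ℝ} (hs : s ≠ 0) (hu : j + k < n → u = 0) :
    s ^ j / s ^ n * (s ^ k * u) = s ^ (j + k - n) * u := by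
  by_cases h : j + k < n
  · simp [hu h]
  · have h1 : s ^ (j + k) = s ^ (j + k - n) * s ^ n := by rw [← pow_add]; congr 1; omega
    rw [← mul_assoc, div_mul_eq_mul_div, ← pow_add, h1, mul_div_cancel_right₀ _ (pow_ne_zero _ hs)]

theorem abs_rescaled_term_le {n j k : ℕ} {s u : ℝ} (hs : 0 < s) (hs1 : s ≤ 1)
    (hu : j + k < n → u = 0) : |s ^ j / s ^ n * (s ^ k * u)| ≤ |u| := by
  rw [rescaled_term hs.ne' hu, abs_mul, abs_of_nonneg (by positivity)]
  exact mul_le_of_le_one_left (abs_nonneg _) (pow_le_one₀ hs.le hs1)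

theorem abs_rescaled_tsum_le {n j : ℕ} {u : ℕ → ℝ} (hu : ∀ k, j + k < n → u k = 0)
    (hsum : Summable fun k => |u k|) {s : ℝ} (hs : 0 < s) (hs1 : s ≤ 1) :
    |s ^ j / s ^ n * ∑' k, s ^ k * u k| ≤ ∑' k, |u k| := by
  rw [← tsum_mul_left, ← Real.norm_eq_abs]
  exact tsum_of_norm_bounded hsum.hasSum fun k => abs_rescaled_term_le hs hs1 (hu k)

theorem tendsto_rescaled_tsum {n j : ℕ} {u : ℕ → ℝ} (hu : ∀ k, j + k < n → u k = 0)
    (hsum : Summable fun k => |u k|) :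
    Filter.Tendsto (fun s : ℝ => s ^ j / s ^ n * ∑' k, s ^ k * u k) (𝓝[>] 0)
      (𝓝 (∑' k, if j + k = n then u k else 0)) := by
  simp only [← tsum_mul_left]
  refine tendsto_tsum_of_dominated_convergence hsum (fun k => ?_) ?_
  · have h1 : Filter.Tendsto (fun s : ℝ => s ^ (j + k - n) * u k) (𝓝[>] 0)
        (𝓝 (if j + k = n then u k else 0)) := by
      have h2 : Filter.Tendsto (fun s : ℝ => s ^ (j + k - n) * u k) (𝓝 0)
          (𝓝 (0 ^ (j + k - n) * u k)) := Continuous.tendsto (by fun_prop) 0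
      convert h2.mono_left nhdsWithin_le_nhds using 2
      rcases lt_trichotomy (j + k) n with h | h | h
      · simp [hu k h]
      · simp [h]
      · rw [if_neg h.ne', zero_pow (by omega), zero_mul]
    refine h1.congr' ?_
    filter_upwards [self_mem_nhdsWithin] with s hs
    exact (rescaled_term (ne_of_gt hs) (hu k)).symm
  · filter_upwards [self_mem_nhdsWithin, Ioc_mem_nhdsGT (zero_lt_one (α := ℝ))] with s hs hs1 k
    exact abs_rescaled_term_le hs hs1.2 (hu k)

/-! ### The rescaled supertrace -/

/-- `λ` in the coordinates of `so(V)`. -/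
def soActionLinear (n : ℕ) : EuclideanSpace ℝ (Pairs n) →ₗ[ℝ] EndExt n where
  toFun x := soAction (soEquiv n x)
  map_add' x y := by
    simp only [soAction_soEquiv, ← map_add, ← Finset.sum_add_distrib, ← add_smul, PiLp.add_apply]
  map_smul' r x := by
    simp only [soAction_soEquiv, ← map_smul, Finset.smul_sum, smul_smul, PiLp.smul_apply,
      smul_eq_mul, RingHom.id_apply]

/-- The functional `a ↦ Str(b a)` on `End ΛV`. -/
def strLeft {n k : ℕ} (b : cliffordFiltration n k) : EndExt n →ₗ[ℝ] ℝ :=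
  supertrace n ∘ₗ LinearMap.mulLeft ℝ (cliffordAction n b)

/-- The coefficients of the power series of `s ↦ Str(b exp(-sλ(y)))`. -/
def strCoeff {n k : ℕ} (b : cliffordFiltration n k) (y : EuclideanSpace ℝ (Pairs n)) (m : ℕ) : ℝ :=
  ((m.factorial : ℝ)⁻¹) * strLeft b ((-soActionLinear n) y ^ m)

theorem strLeft_neg_pow {n k m : ℕ} (b : cliffordFiltration n k)
    (y : EuclideanSpace ℝ (Pairs n)) (h : k + 2 * m ≤ n + n) :
    strLeft b ((-soActionLinear n) y ^ m) = (4 * Real.pi) ^ ((n : ℝ) / 2) *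
      berezin n (symbol n k b * (-rotationSymbol y.ofLp) ^ m) := by
  have h1 : (-soActionLinear n) y ^ m = (-1 : ℝ) ^ m • soAction (soEquiv n y) ^ m := by
    rw [← smul_pow]
    exact congrArg (· ^ m) (neg_one_smul ℝ (_ : EndExt n)).symm
  have h2 : (-rotationSymbol y.ofLp) ^ m = (-1 : ℝ) ^ m • rotationSymbol y.ofLp ^ m := by
    rw [← smul_pow, neg_one_smul]
  rw [h1, h2, map_smul, mul_smul_comm, map_smul, smul_eq_mul, smul_eq_mul, mul_left_comm,
    ← supertrace_mul_soAction_pow b y h]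
  rfl

theorem berezin_symbol_mul_neg_pow_eq_zero {n k m : ℕ} (b : cliffordFiltration n k)
    (x : Pairs n → ℝ) (h : k + 2 * m ≠ n + n) :
    berezin n (symbol n k b * (-rotationSymbol x) ^ m) = 0 := by
  have h1 : (-rotationSymbol x) ^ m = (-1 : ℝ) ^ m • rotationSymbol x ^ m := by
    rw [← smul_pow, neg_one_smul]
  rw [h1, mul_smul_comm, map_smul, berezin_symbol_mul_pow_eq_zero b x h, smul_zero]

/-- The total Clifford order `4i + 2m` is below `2n`. This cancels the negative powers of `s`. -/
theorem strCoeff_eq_zero {n i m : ℕ} (b : cliffordFiltration n (4 * i))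
    (y : EuclideanSpace ℝ (Pairs n)) (h : 2 * i + m < n) : strCoeff b y m = 0 := by
  rw [strCoeff, strLeft_neg_pow b y (by omega),
    berezin_symbol_mul_neg_pow_eq_zero b _ (by omega), mul_zero, mul_zero]

theorem exists_abs_strCoeff_le {n k : ℕ} (b : cliffordFiltration n k) :
    ∃ C M : ℝ, 0 ≤ C ∧ 0 ≤ M ∧ ∀ y m,
      |strCoeff b y m| ≤ C * ((M * ‖y‖) ^ m / m.factorial) := by
  obtain ⟨C, M, hC, hM, h⟩ := exists_abs_pow_le (strLeft b) (-soActionLinear n)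
  refine ⟨C, M, hC, hM, fun y m => ?_⟩
  rw [strCoeff, abs_mul, abs_of_nonneg (by positivity), mul_comm, ← div_eq_mul_inv, ← mul_div_assoc]
  gcongr
  exact h y m

theorem summable_abs_strCoeff {n k : ℕ} (b : cliffordFiltration n k)
    (y : EuclideanSpace ℝ (Pairs n)) : Summable fun m => |strCoeff b y m| := by
  obtain ⟨C, M, -, -, h⟩ := exists_abs_strCoeff_le b
  exact .of_nonneg_of_le (fun _ => abs_nonneg _) (h y)
    ((Real.summable_pow_div_factorial _).mul_left C)

/-- The majorant for dominated convergence: free of `s` and integrable against the Gaussian. -/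
theorem exists_tsum_abs_strCoeff_le {n k : ℕ} (b : cliffordFiltration n k) :
    ∃ C M : ℝ, 0 ≤ C ∧ ∀ y, ∑' m, |strCoeff b y m| ≤ C * Real.exp (M * ‖y‖) := by
  obtain ⟨C, M, hC, -, h⟩ := exists_abs_strCoeff_le b
  refine ⟨C, M, hC, fun y => ?_⟩
  rw [Real.exp_eq_exp_ℝ, NormedSpace.exp_eq_tsum_div, ← tsum_mul_left]
  exact (summable_abs_strCoeff b y).tsum_le_tsum (h y)
    ((Real.summable_pow_div_factorial _).mul_left C)

theorem strLeft_algExp {n k : ℕ} (b : cliffordFiltration n k) (s : ℝ)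
    (y : EuclideanSpace ℝ (Pairs n)) :
    strLeft b (algExp (-soAction (soEquiv n (s • y)))) = ∑' m, s ^ m * strCoeff b y m := by
  have h := hasSum_algExp_end (strLeft b) ((-soActionLinear n) (s • y))
  refine h.tsum_eq.symm.trans (tsum_congr fun m => ?_)
  rw [map_smul, smul_pow, map_smul, strCoeff, smul_eq_mul, mul_left_comm]

theorem continuous_strLeft_algExp {n k : ℕ} (b : cliffordFiltration n k) :
    Continuous fun y => strLeft b (algExp (-soAction (soEquiv n y))) :=
  continuous_algExp_end (strLeft b) (-soActionLinear n)

/-- The single surviving term is resummed to a full exponential, since by degree the Berezin trace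
kills all the other terms. -/
theorem tsum_strCoeff {n i : ℕ} (b : cliffordFiltration n (4 * i))
    (y : EuclideanSpace ℝ (Pairs n)) :
    ∑' m, (if 2 * i + m = n then strCoeff b y m else 0) = (4 * Real.pi) ^ ((n : ℝ) / 2) *
      berezin n (symbol n (4 * i) b * algExp (-rotationSymbol y.ofLp)) := by
  obtain ⟨K, hK⟩ := (isNilpotent_rotationSymbol y.ofLp).neg
  have hz : ∀ m, 2 * i + m ≠ n →
      berezin n (symbol n (4 * i) b * (-rotationSymbol y.ofLp) ^ m) = 0 := fun m hm =>
    berezin_symbol_mul_neg_pow_eq_zero b _ (by omega)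
  have hterm : ∀ m, (if 2 * i + m = n then strCoeff b y m else 0) =
      (4 * Real.pi) ^ ((n : ℝ) / 2) * ((m.factorial : ℝ)⁻¹ *
        berezin n (symbol n (4 * i) b * (-rotationSymbol y.ofLp) ^ m)) := by
    intro m
    split_ifs with h
    · rw [strCoeff, strLeft_neg_pow b y (by omega), mul_left_comm]
    · rw [hz m h, mul_zero, mul_zero]
  rw [tsum_congr hterm, algExp_eq_sum hK, Finset.mul_sum, map_sum, Finset.mul_sum,
    tsum_eq_sum (s := Finset.range K)]
  · simp only [mul_smul_comm, map_smul, smul_eq_mul]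
  · intro m hm
    rw [pow_eq_zero_of_le (by simpa using hm) hK, mul_zero, map_zero, mul_zero, mul_zero]

/-! ### The limit for a fixed Clifford element -/

theorem two_mul_card_pairs (n : ℕ) : 2 * (Fintype.card (Pairs n) : ℝ) = n * (n - 1) := by
  have h : Fintype.card (Pairs n) = ∑ j ∈ Finset.range n, j := by
    rw [Fintype.card_subtype, Finset.card_filter, Fintype.sum_prod_type_right, Finset.sum_range]
    refine Finset.sum_congr rfl fun j _ => ?_
    rw [← Finset.card_filter, Finset.filter_gt_eq_Iio, Fin.card_Iio]
  have h2 := Finset.sum_range_id_mul_two n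
  rw [← h] at h2
  rcases n with _ | n
  · simp
  · have := congrArg (Nat.cast : ℕ → ℝ) h2
    push_cast at this ⊢
    linarith

section Limit

open MeasureTheory Filter

theorem integrable_gaussian_mul_exp_norm (n : ℕ) (M : ℝ) :
    Integrable fun y : EuclideanSpace ℝ (Pairs n) =>
      Real.exp (-‖y‖ ^ 2 / 4) * Real.exp (M * ‖y‖) := by
  have h : Integrable fun y : EuclideanSpace ℝ (Pairs n) => Real.exp (-(1 / 8) * ‖y‖ ^ 2) := by
    -- A nonintegrable function has integral `0`, so the nonzero Gaussian value proves
    -- integrability.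
    refine .of_integral_ne_zero ?_
    rw [GaussianFourier.integral_rexp_neg_mul_sq_norm (by norm_num)]
    positivity
  -- Completing the square: `M r ≤ r²/8 + 2M²`, that is `(r - 4M)² ≥ 0`.
  refine (h.const_mul (Real.exp (2 * M ^ 2))).mono' (by fun_prop) (.of_forall fun y => ?_)
  rw [Real.norm_of_nonneg (by positivity), ← Real.exp_add, ← Real.exp_add]
  refine Real.exp_le_exp.2 ?_
  nlinarith [sq_nonneg (‖y‖ - 4 * M)]

variable {𝕜 : Type*} [RCLike 𝕜]

/-- The limit of the Gaussian integrals, after the substitution `A = s y`. -/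
theorem tendsto_integral_rescaled {n i : ℕ} (b : cliffordFiltration n (4 * i))
    {G : EuclideanSpace ℝ (Pairs n) → 𝕜} (hG : Continuous G) (hGc : HasCompactSupport G) :
    Tendsto (fun s : ℝ => ∫ y : EuclideanSpace ℝ (Pairs n), Real.exp (-‖y‖ ^ 2 / 4) •
        ((s ^ (2 * i) / s ^ n * strLeft b (algExp (-soAction (soEquiv n (s • y))))) • G (s • y)))
      (𝓝[>] 0)
      (𝓝 (((4 * Real.pi) ^ ((n : ℝ) / 2) * √(4 * Real.pi) ^ Fintype.card (Pairs n) *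
        berezin n (symbol n (4 * i) b * algExp (-(1 / 2 : ℝ) • quarticElement n))) • G 0)) := by
  obtain ⟨C, M, hC, hCM⟩ := exists_tsum_abs_strCoeff_le b
  obtain ⟨B, hB⟩ := hG.bounded_above_of_compact_support hGc
  have hlim : ∫ y : EuclideanSpace ℝ (Pairs n), Real.exp (-‖y‖ ^ 2 / 4) •
      ((∑' m, if 2 * i + m = n then strCoeff b y m else 0) • G 0) =
      ((4 * Real.pi) ^ ((n : ℝ) / 2) * √(4 * Real.pi) ^ Fintype.card (Pairs n) *
        berezin n (symbol n (4 * i) b * algExp (-(1 / 2 : ℝ) • quarticElement n))) • G 0 := by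
    have h := integral_gaussian_rotationSymbol
      (berezin n ∘ₗ LinearMap.mulLeft ℝ (symbol n (4 * i) b))
    simp only [LinearMap.comp_apply, LinearMap.mulLeft_apply] at h
    simp only [smul_smul, tsum_strCoeff]
    rw [integral_smul_const, mul_assoc, ← h, ← integral_const_mul]
    exact congrArg (· • G 0) (integral_congr_ae (.of_forall fun y => mul_left_comm _ _ _))
  rw [← hlim]
  refine tendsto_integral_filter_of_dominated_convergence
    (fun y => (Real.exp (-‖y‖ ^ 2 / 4) * Real.exp (M * ‖y‖)) * (C * B)) ?_ ?_ ?_ ?_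
  · refine .of_forall fun s => Continuous.aestronglyMeasurable ?_
    have h1 : Continuous fun y : EuclideanSpace ℝ (Pairs n) =>
        strLeft b (algExp (-soAction (soEquiv n (s • y)))) :=
      (continuous_strLeft_algExp b).comp (continuous_const_smul s)
    have h2 : Continuous fun y => G (s • y) := hG.comp (continuous_const_smul s)
    have h3 : Continuous fun y : EuclideanSpace ℝ (Pairs n) => Real.exp (-‖y‖ ^ 2 / 4) := by
      fun_prop
    exact h3.smul ((continuous_const.mul h1).smul h2)
  · filter_upwards [self_mem_nhdsWithin, Ioc_mem_nhdsGT (zero_lt_one (α := ℝ))] with s hs hs1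
    refine .of_forall fun y => ?_
    rw [norm_smul, norm_smul, Real.norm_of_nonneg (Real.exp_pos _).le, strLeft_algExp,
      Real.norm_eq_abs, mul_assoc]
    refine mul_le_mul_of_nonneg_left ?_ (Real.exp_pos _).le
    calc _ ≤ (C * Real.exp (M * ‖y‖)) * B := by
          refine mul_le_mul ?_ (hB _) (norm_nonneg _) (by positivity)
          exact (abs_rescaled_tsum_le (fun m hm => strCoeff_eq_zero b y hm)
            (summable_abs_strCoeff b y) hs hs1.2).trans (hCM y)
      _ = _ := by ring
  · exact (integrable_gaussian_mul_exp_norm n M).mul_const _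
  · refine .of_forall fun y => ?_
    refine Tendsto.const_smul ?_ _
    simp only [strLeft_algExp]
    refine (tendsto_rescaled_tsum (fun m hm => strCoeff_eq_zero b y hm)
      (summable_abs_strCoeff b y)).smul ?_
    have h1 : Tendsto (fun s : ℝ => G (s • y)) (𝓝 0) (𝓝 (G ((0 : ℝ) • y))) :=
      (hG.comp (continuous_id.smul continuous_const)).tendsto 0
    rw [zero_smul] at h1
    exact h1.mono_left nhdsWithin_le_nhds

/-- With `N` the number of pairs, the Jacobian `√t^N` cancels the `t^{-N/2}` of the prefactor and
leaves `√t^{2i-n}`. -/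
theorem normalization_eq {n i : ℕ} {t : ℝ} (ht : 0 < t) :
    (4 * Real.pi * t) ^ (-((n : ℝ) + (n : ℝ) * ((n : ℝ) - 1) / 2) / 2) * t ^ i *
        √t ^ Fintype.card (Pairs n) =
      ((4 * Real.pi) ^ ((n : ℝ) / 2) * √(4 * Real.pi) ^ Fintype.card (Pairs n))⁻¹ *
        (√t ^ (2 * i) / √t ^ n) := by
  have h4 : 0 < 4 * Real.pi := by positivity
  have hst : 0 < √t := Real.sqrt_pos.2 ht
  have hN : -((n : ℝ) + (n : ℝ) * ((n : ℝ) - 1) / 2) / 2 =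
      -((n : ℝ) / 2 + (Fintype.card (Pairs n) : ℝ) / 2) := by
    rw [← two_mul_card_pairs]; ring
  have hs : ∀ {x : ℝ}, 0 < x → ∀ m : ℕ, x ^ ((m : ℝ) / 2) = √x ^ m := fun {x} hx m => by
    rw [Real.sqrt_eq_rpow, ← Real.rpow_natCast, ← Real.rpow_mul hx.le]
    congr 1
    ring
  rw [hN, Real.mul_rpow h4.le ht.le, Real.rpow_neg h4.le, Real.rpow_neg ht.le, Real.rpow_add h4,
    Real.rpow_add ht, hs h4, hs h4, hs ht, hs ht, pow_mul, Real.sq_sqrt ht.le]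
  field_simp

theorem tendsto_integral_strLeft {n i : ℕ} (b : cliffordFiltration n (4 * i))
    {G : EuclideanSpace ℝ (Pairs n) → 𝕜} (hG : Continuous G) (hGc : HasCompactSupport G) :
    Tendsto (fun t : ℝ =>
        ((4 * Real.pi * t) ^ (-((n : ℝ) + (n : ℝ) * ((n : ℝ) - 1) / 2) / 2) * t ^ i : ℝ) •
          ∫ x : EuclideanSpace ℝ (Pairs n), Real.exp (-‖x‖ ^ 2 / (4 * t)) •
            (strLeft b (algExp (-soAction (soEquiv n x))) • G x))
      (𝓝[>] 0)
      (𝓝 (berezin n (symbol n (4 * i) b * algExp (-(1 / 2 : ℝ) • quarticElement n)) • G 0)) := by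
  set c := (4 * Real.pi) ^ ((n : ℝ) / 2) * √(4 * Real.pi) ^ Fintype.card (Pairs n) with hc
  have hc0 : c ≠ 0 := by positivity
  have hsqrt : Tendsto Real.sqrt (𝓝[>] 0) (𝓝[>] 0) := by
    refine tendsto_nhdsWithin_iff.2 ⟨?_, ?_⟩
    · have := Real.continuous_sqrt.tendsto 0
      rw [Real.sqrt_zero] at this
      exact this.mono_left nhdsWithin_le_nhds
    · filter_upwards [self_mem_nhdsWithin] with t ht using Real.sqrt_pos.2 ht
  have h := ((tendsto_integral_rescaled b hG hGc).comp hsqrt).const_smul c⁻¹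
  rw [← hc, smul_smul, ← mul_assoc, inv_mul_cancel₀ hc0, one_mul] at h
  refine h.congr' ?_
  filter_upwards [self_mem_nhdsWithin] with t ht
  have hst : 0 < √t := Real.sqrt_pos.2 ht
  -- The substitution `x = √t y`.
  have hsub := Measure.integral_comp_smul (volume : Measure (EuclideanSpace ℝ (Pairs n)))
    (fun x => Real.exp (-‖x‖ ^ 2 / (4 * t)) •
      (strLeft b (algExp (-soAction (soEquiv n x))) • G x)) √t
  rw [finrank_euclideanSpace, abs_of_pos (by positivity), eq_inv_smul_iff₀ (by positivity)] at hsub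
  rw [← hsub, smul_smul, normalization_eq ht, ← hc, ← smul_smul, Function.comp_apply]
  congr 1
  rw [← integral_smul]
  refine integral_congr_ae (.of_forall fun y => ?_)
  have h1 : -‖√t • y‖ ^ 2 / (4 * t) = -‖y‖ ^ 2 / 4 := by
    rw [norm_smul, mul_pow, Real.norm_of_nonneg hst.le, Real.sq_sqrt (le_of_lt ht)]
    have : t ≠ 0 := ne_of_gt ht
    field_simp
  simp only [h1, smul_smul]
  congr 1
  ring

theorem integrable_strLeft {n k : ℕ} (b : cliffordFiltration n k)
    {G : EuclideanSpace ℝ (Pairs n) → 𝕜} (hG : Continuous G) (hGc : HasCompactSupport G) (t : ℝ) :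
    Integrable fun x : EuclideanSpace ℝ (Pairs n) => Real.exp (-‖x‖ ^ 2 / (4 * t)) •
      (strLeft b (algExp (-soAction (soEquiv n x))) • G x) := by
  have h : Continuous fun x : EuclideanSpace ℝ (Pairs n) => Real.exp (-‖x‖ ^ 2 / (4 * t)) := by
    fun_prop
  refine (h.smul ((continuous_strLeft_algExp b).smul hG)).integrable_of_hasCompactSupport
    (hGc.mono fun x hx h0 => hx ?_)
  have h1 : strLeft b (algExp (-soAction (soEquiv n x))) • G x = 0 := by rw [h0, smul_zero]
  exact (congrArg (Real.exp (-‖x‖ ^ 2 / (4 * t)) • ·) h1).trans (smul_zero _)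

end Limit

/-! ### Coefficients in `End F` -/

instance cl_finite (n : ℕ) : Module.Finite ℝ (Cl n) :=
  have : Module.Finite ℝ (ExteriorAlgebra ℝ (VV n)) := .of_basis (basisVV n).ExteriorAlgebra
  .equiv (CliffordAlgebra.equivExterior (-splitForm n)).symm

section Coefficients

variable {𝕜 F : Type*} [RCLike 𝕜] [AddCommGroup F] [Module 𝕜 F] [Module ℝ F]
  [IsScalarTower ℝ 𝕜 F]

theorem tensorTrace_tmul {W : Type*} [AddCommGroup W] [Module ℝ W] (ℓ : W →ₗ[ℝ] ℝ) (w : W)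
    (f : Module.End 𝕜 F) : tensorTrace 𝕜 F ℓ (w ⊗ₜ f) = ℓ w • LinearMap.trace 𝕜 F f := by
  simp [tensorTrace]

theorem tensorTrace_comp {W W' : Type*} [AddCommGroup W] [Module ℝ W] [AddCommGroup W']
    [Module ℝ W'] (ℓ : W' →ₗ[ℝ] ℝ) (g : W →ₗ[ℝ] W') (x : W ⊗[ℝ] Module.End 𝕜 F) :
    tensorTrace 𝕜 F (ℓ ∘ₗ g) x = tensorTrace 𝕜 F ℓ (g.rTensor _ x) := by
  induction x with
  | zero => simp
  | tmul w f => simp [tensorTrace_tmul]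
  | add x y hx hy => simp only [map_add, hx, hy]

theorem rTensor_mul_tmul_one {W R : Type*} [AddCommGroup W] [Module ℝ W] [Ring R] [Algebra ℝ R]
    (g : W →ₗ[ℝ] R) (c : R) (x : W ⊗[ℝ] Module.End 𝕜 F) :
    g.rTensor (Module.End 𝕜 F) x * (c ⊗ₜ 1) = (LinearMap.mulRight ℝ c ∘ₗ g).rTensor _ x := by
  induction x with
  | zero => simp
  | tmul w f => simp
  | add x y hx hy => simp only [map_add, add_mul, hx, hy]

theorem tmul_one_mul_rTensor {W R : Type*} [AddCommGroup W] [Module ℝ W] [Ring R] [Algebra ℝ R]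
    (g : W →ₗ[ℝ] R) (c : R) (x : W ⊗[ℝ] Module.End 𝕜 F) :
    (c ⊗ₜ 1) * g.rTensor (Module.End 𝕜 F) x = (LinearMap.mulLeft ℝ c ∘ₗ g).rTensor _ x := by
  induction x with
  | zero => simp
  | tmul w f => simp
  | add x y hx hy => simp only [map_add, mul_add, hx, hy]

/-- `ℓ ⊗ Tr` in terms of a basis of the first factor. -/
theorem tensorTrace_eq_sum {W ι : Type*} [AddCommGroup W] [Module ℝ W] [Fintype ι]
    (b : Module.Basis ι ℝ W) (ℓ : W →ₗ[ℝ] ℝ) (x : W ⊗[ℝ] Module.End 𝕜 F) :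
    tensorTrace 𝕜 F ℓ x = ∑ j, ℓ (b j) • tensorTrace 𝕜 F (b.coord j) x := by
  induction x with
  | zero => simp
  | tmul w f =>
    simp only [tensorTrace_tmul, smul_smul, ← Finset.sum_smul]
    congr 1
    conv_lhs => rw [← b.sum_repr w]
    rw [map_sum]
    refine Finset.sum_congr rfl fun j _ => ?_
    rw [map_smul, smul_eq_mul, mul_comm, Module.Basis.coord_apply]
  | add x y hx hy => simp only [map_add, hx, hy, smul_add, Finset.sum_add_distrib]

/-- Separates the Clifford elements, now fixed, from scalar functions of `A` that absorb the trace
over `F`. -/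
theorem strExp_eq {n k : ℕ} {ι : Type*} [Fintype ι]
    (b : Module.Basis ι ℝ (cliffordFiltration n k))
    (a : cliffordFiltration n k ⊗[ℝ] Module.End 𝕜 F) (A : SO n) :
    strExp a A = ∑ j, strLeft (b j) (algExp (-soAction A)) • tensorTrace 𝕜 F (b.coord j) a := by
  rw [strExp, rTensor_mul_tmul_one, ← tensorTrace_comp, tensorTrace_eq_sum b]
  rfl

/-- The exponential is central, so it may stand to the left of the symbol although the rescaled
supertrace produces it on the right. -/
theorem algExp_quarticElement_commute {n : ℕ} (x : ExteriorAlgebra ℝ (VV n)) :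
    algExp (-(1 / 2 : ℝ) • quarticElement n) * x = x * algExp (-(1 / 2 : ℝ) • quarticElement n) := by
  have h : algExp (-(1 / 2 : ℝ) • quarticElement n) ∈
      Subalgebra.center ℝ (ExteriorAlgebra ℝ (VV n)) := by
    rw [← val_algExp_sum_sq]
    exact Subtype.coe_prop _
  exact (Subalgebra.mem_center_iff.1 h x).symm

theorem tensorTrace_berezin_eq {n k : ℕ} {ι : Type*} [Fintype ι]
    (b : Module.Basis ι ℝ (cliffordFiltration n k))
    (a : cliffordFiltration n k ⊗[ℝ] Module.End 𝕜 F) :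
    tensorTrace 𝕜 F (berezin n) ((algExp (-(1 / 2 : ℝ) • quarticElement n) ⊗ₜ[ℝ]
        (1 : Module.End 𝕜 F)) * (symbol n k).rTensor (Module.End 𝕜 F) a) =
      ∑ j, berezin n (symbol n k (b j) * algExp (-(1 / 2 : ℝ) • quarticElement n)) •
        tensorTrace 𝕜 F (b.coord j) a := by
  rw [tmul_one_mul_rTensor, ← tensorTrace_comp, tensorTrace_eq_sum b]
  simp only [LinearMap.comp_apply, LinearMap.mulLeft_apply, algExp_quarticElement_commute]

theorem SmoothOnSO.continuous {n : ℕ} {W : Type*} [AddCommGroup W] [Module ℝ W] {φ : SO n → W}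
    (hφ : SmoothOnSO φ) (g : W →ₗ[ℝ] 𝕜) : Continuous fun x => g (φ (soEquiv n x)) := by
  have h1 := (hφ (RCLike.reLm ∘ₗ g)).continuous
  have h2 := (hφ (RCLike.imLm ∘ₗ g)).continuous
  have h3 : (fun x => g (φ (soEquiv n x))) = fun x =>
      ((RCLike.re (g (φ (soEquiv n x))) : ℝ) : 𝕜) +
        ((RCLike.im (g (φ (soEquiv n x))) : ℝ) : 𝕜) * RCLike.I :=
    funext fun x => (RCLike.re_add_im _).symm
  rw [h3]
  exact (RCLike.continuous_ofReal.comp h1).add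
    ((RCLike.continuous_ofReal.comp h2).mul continuous_const)

theorem hasCompactSupport_comp_soEquiv {n : ℕ} {W W' : Type*} [AddCommMonoid W] [Module ℝ W]
    [AddCommMonoid W'] [Module ℝ W'] {φ : SO n → W ⊗[ℝ] W'} (hc : HasCompactSupport φ)
    (g : W ⊗[ℝ] W' →ₗ[ℝ] 𝕜) :
    HasCompactSupport fun x => g (φ (soEquiv n x)) := by
  -- The coordinates are matrix entries, so the compact support in `so(V)` has compact image in
  -- coordinate space.
  have h : Continuous (soEquiv n).symm := by
    refine (PiLp.continuous_toLp 2 _).comp (continuous_pi fun p => ?_)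
    exact (continuous_apply_apply p.1.1 p.1.2).comp continuous_subtype_val
  refine HasCompactSupport.of_support_subset_isCompact (hc.isCompact.image h) fun x hx => ?_
  refine ⟨soEquiv n x, subset_tsupport _ fun h0 => hx ?_, by simp⟩
  simp only [h0, map_zero]

/-- The Gaussian limit of the supertrace. -/
theorem tendsto_gaussian_integral_strExp [FiniteDimensional 𝕜 F] (n i : ℕ)
    (φ : SO n →
      cliffordFiltration n (4 * i) ⊗[ℝ] Module.End 𝕜 F)
    (hφ : SmoothOnSO φ) (hc : HasCompactSupport φ) :
    Filter.Tendsto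
      (fun t : ℝ =>
        ((4 * Real.pi * t) ^ (-((n : ℝ) + (n : ℝ) * ((n : ℝ) - 1) / 2) / 2) * t ^ i : ℝ) •
          soIntegral fun A : SO n =>
            Real.exp (-soNormSq A / (4 * t)) •
              strExp (φ A) A)
      (𝓝[>] 0)
      (𝓝 (tensorTrace 𝕜 F (berezin n)
        ((algExp (-(1 / 2 : ℝ) • quarticElement n)
            ⊗ₜ[ℝ] (1 : Module.End 𝕜 F)) *
          (symbol n (4 * i)).rTensor (Module.End 𝕜 F) (φ 0)))) := by
  obtain ⟨ι, _, ⟨b⟩⟩ : ∃ (ι : Type) (_ : Fintype ι),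
      Nonempty (Module.Basis ι ℝ (cliffordFiltration n (4 * i))) :=
    ⟨_, inferInstance, ⟨Module.finBasis ℝ (cliffordFiltration n (4 * i))⟩⟩
  have hG := fun j => hφ.continuous (tensorTrace 𝕜 F (b.coord j))
  have hGc := fun j => hasCompactSupport_comp_soEquiv hc (tensorTrace 𝕜 F (b.coord j))
  have h := tendsto_finsetSum Finset.univ fun j _ =>
    tendsto_integral_strLeft (b j) (hG j) (hGc j)
  rw [tensorTrace_berezin_eq b]
  -- The limit is taken at the origin of the coordinates, which is `A = 0`.
  simp only [map_zero] at h
  refine h.congr fun t => ?_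
  rw [← Finset.smul_sum, ← MeasureTheory.integral_finsetSum]
  · congr 1
    refine MeasureTheory.integral_congr_ae (.of_forall fun x => ?_)
    simp only [soNormSq_soEquiv, strExp_eq b, Finset.smul_sum]
  · exact fun j _ => integrable_strLeft (b j) (hG j) (hGc j) t

end Coefficients

end GaussianSupertrace

end

theorem mainTheorem6 {𝕜 F : Type*} [RCLike 𝕜] [AddCommGroup F] [Module 𝕜 F] [Module ℝ F]
    [IsScalarTower ℝ 𝕜 F] [FiniteDimensional 𝕜 F] (n i : ℕ)
    (φ : GaussianSupertrace.SO n →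
      GaussianSupertrace.cliffordFiltration n (4 * i) ⊗[ℝ] Module.End 𝕜 F)
    (hφ : GaussianSupertrace.SmoothOnSO φ) (hc : HasCompactSupport φ) :
    Filter.Tendsto
      (fun t : ℝ =>
        ((4 * Real.pi * t) ^ (-((n : ℝ) + (n : ℝ) * ((n : ℝ) - 1) / 2) / 2) * t ^ i : ℝ) •
          GaussianSupertrace.soIntegral fun A : GaussianSupertrace.SO n =>
            Real.exp (-GaussianSupertrace.soNormSq A / (4 * t)) •
              GaussianSupertrace.strExp (φ A) A)
      (𝓝[>] 0)
      (𝓝 (GaussianSupertrace.tensorTrace 𝕜 F (GaussianSupertrace.berezin n)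
        ((GaussianSupertrace.algExp (-(1 / 2 : ℝ) • GaussianSupertrace.quarticElement n)
            ⊗ₜ[ℝ] (1 : Module.End 𝕜 F)) *
          (GaussianSupertrace.symbol n (4 * i)).rTensor (Module.End 𝕜 F) (φ 0)))) := 
  GaussianSupertrace.tendsto_gaussian_integral_strExp n i φ hφ hc
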